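/- \textbf{Setting.} Let $\mathbb{R}^{2,1}$ be $\mathbb{R}^3$ with the form $\langle x,y\rangle=x_1y_1+x_2y_2-x_3y_3$, let $\mathbb{H}^2$ be the upper sheet of $\{\langle x,x\rangle=-1\}$, $G=\mathrm{Isom}(\mathbb{H}^2)$ (the linear Lorentz transformations preserving $\mathbb{H}^2$, orientation-reversing ones included) and $\mathfrak g$ its Lie algebra. A horoball of $\mathbb{H}^2$ is identified with the future-pointing light-like vector $v$ such that it equals $\{w\in\mathbb{H}^2:\langle w,v\rangle>-1\}$; its centre is the ideal point $[v]$. Let $S$ be a connected, possibly non-orientable hyperbolic surface with $Q\ge 1$ decorated spikes: a complete finite-area hyperbolic surface with geodesic boundary (without cusps), whose boundary components are closed geodesics or crowns of infinite geodesics, $Q$ being the number of spikes, with a horoball chosen at each spike (the horoballs need not be disjoint). A decorated metric $m=[\rho,\mathbf x,\mathbf h]$ on $S$ is given by a discrete, faithful, convex cocompact holonomy representation $\rho:\pi_1(S)\to G$ of the finitely generated free group $\pi_1(S)$, and by future-pointing light-like vectors $v_1,\dots,v_Q$ representing lifts of the decorated spikes, whose ideal points lie outside the limit set of $\rho(\pi_1(S))$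 and in pairwise distinct orbits, up to the simultaneous action of $G$; if $\pi_1(S)$ is trivial ($S$ is an ideal polygon) then $Q\ge 3$. The space $T_m$ of infinitesimal deformations of $m$ is the finite-dimensional vector space of pairs $(u,(\dot v_i)_i)$, where $u:\pi_1(S)\to\mathfrak g$ is a cocycle, $u(gh)=u(g)+\mathrm{Ad}(\rho(g))u(h)$, and $\dot v_i$ is tangent to the light cone at $v_i$, modulo the pairs $\big(g\mapsto X-\mathrm{Ad}(\rho(g))X,\ (Xv_i)_i\big)$ with $X\in\mathfrak g$. For a closed geodesic $\gamma$ let $l_\gamma(m)>0$ be its length. A horoball connection $\beta$ is a geodesic of $S$ joining two (not necessarily distinct) spikes; if it lifts to the geodesic joining the decorated ideal points given by $w_1,w_2$, its signed length is $l_\beta(m)=\ln\!\big(-\tfrac12\langle w_1,w_2\rangle\big)$. Write $\mathrm dl(m)(v)$ for the derivative of such a length at $m$ in the direction $v\in T_m$. The admissible cone $\mathrm{Adm}(m)$ is the set of all $v\in T_m$ for which there is $\varepsilon>0$ such that $$\frac{\mathrm dl_\gamma(m)(v)}{l_\gamma(m)}\ge\varepsilon\ \text{ for every closed geodesic }\gamma,\qquad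 \frac{\mathrm dl_\beta(m)(v)}{l_\beta(m)}\ge\varepsilon\ \text{ for every horoball connection }\beta\text{ with } l_\beta(m)>0,$$ $$\mathrm dl_\beta(m)(v)\ge\varepsilon\ \text{ for every horoball connection }\beta\text{ with } l_\beta(m)\le 0.$$ \textbf{Theorem.} For every decorated metric $m$ on a hyperbolic surface with decorated spikes, $\mathrm{Adm}(m)$ is an open convex cone in $T_m$: it is open in $T_m$, it is convex, and $tv\in\mathrm{Adm}(m)$ for all $v\in\mathrm{Adm}(m)$ and $t>0$. -/

import Mathlib

open scoped Matrix

noncomputable section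

namespace DecoratedSurface

/-! ## The hyperboloid model of the hyperbolic plane -/

/-- The vector space underlying Minkowski space of signature `(2,1)`. -/
abbrev Mink : Type := Fin 3 → ℝ

/-- Real `3 × 3` matrices, acting on `Mink`. -/
abbrev Mat3 : Type := Matrix (Fin 3) (Fin 3) ℝ

/-- The Lorentzian bilinear form `x₁y₁ + x₂y₂ - x₃y₃`. -/
def mink (x y : Mink) : ℝ := x 0 * y 0 + x 1 * y 1 - x 2 * y 2

/-- The hyperbolic plane: the upper sheet of the hyperboloid. -/
def hypPlane : Set Mink := {x | mink x x = -1 ∧ 0 < x 2}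

/-- Future-pointing light-like vectors. Such a vector `v` is the same thing as an ideal point
(the ray spanned by `v`) together with an open horoball `{w | -1 < ⟨w, v⟩}` centred at it. -/
def futureLight : Set Mink := {v | mink v v = 0 ∧ 0 < v 2}

/-- The full isometry group of the hyperbolic plane (orientation-reversing isometries included):
the linear Lorentz transformations that preserve the upper sheet. -/
def isomGroup : Subgroup (Mat3)ˣ where
  carrier := {A | (∀ x y : Mink, mink ((A : Mat3) *ᵥ x) ((A : Mat3) *ᵥ y) = mink x y) ∧
    ∀ x : Mink, (A : Mat3) *ᵥ x ∈ hypPlane ↔ x ∈ hypPlane}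
  one_mem' := by simp
  mul_mem' := by
    rintro A B ⟨hA, hA'⟩ ⟨hB, hB'⟩
    refine ⟨fun x y => ?_, fun x => ?_⟩
    · rw [Units.val_mul, ← Matrix.mulVec_mulVec, ← Matrix.mulVec_mulVec, hA, hB]
    · rw [Units.val_mul, ← Matrix.mulVec_mulVec, hA', hB']
  inv_mem' := by
    rintro A ⟨hA, hA'⟩
    have key : ∀ x : Mink, (A : Mat3) *ᵥ ((A⁻¹ : (Mat3)ˣ) : Mat3) *ᵥ x = x := fun x => by
      rw [Matrix.mulVec_mulVec, Units.mul_inv, Matrix.one_mulVec]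
    refine ⟨fun x y => ?_, fun x => ?_⟩
    · rw [← hA, key, key]
    · rw [← hA', key]

/-- The Lie algebra of the isometry group, i.e. the Killing fields of the hyperbolic plane:
the matrices that are skew for the Lorentzian form. -/
def lieAlg : Submodule ℝ Mat3 where
  carrier := {X | ∀ x y : Mink, mink (X *ᵥ x) y + mink x (X *ᵥ y) = 0}
  zero_mem' := by intro x y; simp [mink]
  add_mem' := by
    intro X Y hX hY x y
    have h1 := hX x y
    have h2 := hY x y
    simp only [mink, Matrix.add_mulVec, Pi.add_apply] at *
    linarith
  smul_mem' := by
    intro c X hX x y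
    have h1 := hX x y
    simp only [mink, Matrix.smul_mulVec, Pi.smul_apply, smul_eq_mul] at *
    linear_combination c * h1

/-- Central projection of the upper half space to the affine chart `x₃ = 1`. It maps `hypPlane`
to the open unit disk (Klein model) and future light-like rays to the unit circle. -/
def klein (x : Mink) : ℝ × ℝ := (x 0 / x 2, x 1 / x 2)

/-! ## Surfaces with decorated spikes -/

/-- `m : DecoratedMetric r Q` is a representative `(ρ, 𝐱, 𝐡)` of a decorated metric on a connected
hyperbolic surface with `Q` decorated spikes whose fundamental group is free of rank `r`.
The holonomy `ρ` is discrete, faithful and convex cocompact. The spikes are `Q` ideal points in the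
domain of discontinuity of `ρ`, in pairwise distinct orbits, and the `i`-th spike together
with its horoball is the light-like vector `v i`. The surface is the quotient by `ρ` of the convex
hull of the limit set and of the orbits of the spikes; the gaps of the limit set that contain
spikes correspond to crowns, the others to closed geodesic boundary components.
If `r = 0` the surface is an ideal polygon with `Q ≥ 3` vertices. -/
structure DecoratedMetric (r Q : ℕ) where
  /-- the holonomy representation -/
  ρ : FreeGroup (Fin r) →* isomGroup
  faithful : Function.Injective ρ
  discrete : DiscreteTopology ρ.range
  /-- there is a non-empty closed convex invariant subset of the hyperbolic plane with compact
  quotient -/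
  convex_cocompact : ∃ C : Set Mink, C ⊆ hypPlane ∧ C.Nonempty ∧ IsClosed C ∧
    (∀ x ∈ C, ∀ y ∈ C, ∀ a b : ℝ, 0 ≤ a → 0 ≤ b →
      a • x + b • y ∈ hypPlane → a • x + b • y ∈ C) ∧
    (∀ g, ∀ x ∈ C, ((ρ g : (Mat3)ˣ) : Mat3) *ᵥ x ∈ C) ∧
    ∃ K ⊆ C, IsCompact K ∧ ∀ x ∈ C, ∃ g, ∃ y ∈ K, x = ((ρ g : (Mat3)ˣ) : Mat3) *ᵥ y
  /-- the decorated spikes -/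
  v : Fin Q → Mink
  v_light : ∀ i, v i ∈ futureLight
  /-- no spike lies in the limit set, the set of points of the circle at infinity that are
  in the closure of the orbit of `(0,0,1)` -/
  v_not_limit : ∀ i, klein (v i) ∉
    closure (Set.range fun g => klein (((ρ g : (Mat3)ˣ) : Mat3) *ᵥ ![0, 0, 1]))
  /-- distinct spikes are not equivalent under the fundamental group -/
  v_inequiv : ∀ i j g, ∀ c : ℝ, v i = c • (((ρ g : (Mat3)ˣ) : Mat3) *ᵥ v j) → i = j
  spikes_pos : 0 < Q
  polygon : r = 0 → 3 ≤ Q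

/-- Length of the closed geodesic of a hyperbolic element `A`, as a function of the matrix.
If `A` is a translation of length `l` then `det A = 1` and `tr A = 2 cosh l + 1`; if it is a glide
reflection with translation length `l` then `det A = -1` and `tr A = 2 cosh l - 1`. -/
def hypLength (A : Mat3) : ℝ := Real.arcosh ((A.trace - A.det) / 2)

/-- Signed length of the horoball connection joining two decorated ideal points. -/
def horoLength (p : Mink × Mink) : ℝ := Real.log (-(mink p.1 p.2) / 2)

namespace DecoratedMetric

variable {r Q : ℕ} (m : DecoratedMetric r Q)

/-- The matrix of the holonomy of `g`. -/
def hol (g : FreeGroup (Fin r)) : Mat3 := ((m.ρ g : (Mat3)ˣ) : Mat3)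

/-! ### Infinitesimal deformations -/

/-- First-order variations of the triple `(ρ, 𝐱, 𝐡)`: a `ρ`-cocycle `u` with values in the
Lie algebra (the variation of `ρ(g)` is `u(g) ρ(g)`) and, for each spike, a tangent vector at `v i`
to the light cone. Pairs are elements of a space of functions with the product topology. -/
def variations : Submodule ℝ ((FreeGroup (Fin r) → Mat3) × (Fin Q → Mink)) where
  carrier := {z | (∀ g, z.1 g ∈ lieAlg) ∧
    (∀ g h, z.1 (g * h) = z.1 g + m.hol g * z.1 h * m.hol g⁻¹) ∧
    ∀ i, mink (m.v i) (z.2 i) = 0}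
  zero_mem' := by simp [mink, lieAlg.zero_mem]
  add_mem' := by
    rintro z z' ⟨h1, h2, h3⟩ ⟨h1', h2', h3'⟩
    refine ⟨fun g => lieAlg.add_mem (h1 g) (h1' g), fun g h => ?_, fun i => ?_⟩
    · simp only [Prod.fst_add, Pi.add_apply, h2 g h, h2' g h, mul_add, add_mul]
      abel
    · have e1 := h3 i
      have e2 := h3' i
      simp only [mink, Prod.snd_add, Pi.add_apply] at *
      linarith
  smul_mem' := by
    rintro c z ⟨h1, h2, h3⟩
    refine ⟨fun g => lieAlg.smul_mem c (h1 g), fun g h => ?_, fun i => ?_⟩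
    · simp only [Prod.smul_fst, Pi.smul_apply, h2 g h, smul_add, Matrix.mul_smul, Matrix.smul_mul]
    · have e1 := h3 i
      simp only [mink, Prod.smul_snd, Pi.smul_apply, smul_eq_mul] at *
      linear_combination c * e1

/-- The trivial variations: the tangent space at `(ρ, 𝐱, 𝐡)` to its orbit under the isometry group.
The Killing field `X` gives the coboundary `X - Ad(ρ(g)) X` and moves `v i` by `X v i`. -/
def trivialVariations : Submodule ℝ ((FreeGroup (Fin r) → Mat3) × (Fin Q → Mink)) where
  carrier := {z | ∃ X ∈ lieAlg, (∀ g, z.1 g = X - m.hol g * X * m.hol g⁻¹) ∧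
    ∀ i, z.2 i = X *ᵥ m.v i}
  zero_mem' := ⟨0, lieAlg.zero_mem, by simp, by simp⟩
  add_mem' := by
    rintro z z' ⟨X, hX, h1, h2⟩ ⟨Y, hY, h1', h2'⟩
    refine ⟨X + Y, lieAlg.add_mem hX hY, fun g => ?_, fun i => ?_⟩
    · simp only [Prod.fst_add, Pi.add_apply, h1, h1', mul_add, add_mul]
      abel
    · simp only [Prod.snd_add, Pi.add_apply, h2, h2', Matrix.add_mulVec]
  smul_mem' := by
    rintro c z ⟨X, hX, h1, h2⟩
    refine ⟨c • X, lieAlg.smul_mem c hX, fun g => ?_, fun i => ?_⟩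
    · simp only [Prod.smul_fst, Pi.smul_apply, h1, smul_sub, Matrix.mul_smul, Matrix.smul_mul]
    · simp only [Prod.smul_snd, Pi.smul_apply, h2, Matrix.smul_mulVec]

/-- The tangent space at `m` to the deformation space: infinitesimal deformations of `m`, i.e.
variations modulo trivial ones. It is finite-dimensional, and carries the quotient topology. -/
abbrev TangentSpace : Type :=
  m.variations ⧸ m.trivialVariations.comap m.variations.subtype

/-! ### Length functions and their derivatives -/

/-- Length of the closed geodesic in the free homotopy class of `g`. -/
def closedLength (g : FreeGroup (Fin r)) : ℝ := hypLength (m.hol g)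

/-- Derivative of the length of the closed geodesic `g` under the variation `z`. -/
def dClosedLength (g : FreeGroup (Fin r)) (z : m.variations) : ℝ :=
  lineDeriv ℝ hypLength (m.hol g) (z.1.1 g * m.hol g)

/-- `(i, j, g)` encodes the horoball connection that lifts to the geodesic joining the
decorated ideal points `v i` and `ρ(g) (v j)`, which have to be distinct. Up to the action of the
fundamental group, every horoball connection has such a lift. -/
def Connection (_m : DecoratedMetric r Q) : Type :=
  {c : Fin Q × Fin Q × FreeGroup (Fin r) // ¬ (c.1 = c.2.1 ∧ c.2.2 = 1)}

/-- Signed length of a horoball connection. -/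
def connLength (c : m.Connection) : ℝ :=
  horoLength (m.v c.1.1, m.hol c.1.2.2 *ᵥ m.v c.1.2.1)

/-- Derivative of the length of a horoball connection under the variation `z`. -/
def dConnLength (c : m.Connection) (z : m.variations) : ℝ :=
  lineDeriv ℝ horoLength (m.v c.1.1, m.hol c.1.2.2 *ᵥ m.v c.1.2.1)
    (z.1.2 c.1.1, (z.1.1 c.1.2.2 * m.hol c.1.2.2) *ᵥ m.v c.1.2.1 +
      m.hol c.1.2.2 *ᵥ z.1.2 c.1.2.1)

/-- The variation `z` uniformly lengthens all closed geodesics and all horoball connections: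
relatively to the length for closed geodesics and for connections of positive length, and
absolutely for connections of non-positive length (which exist only when horoballs meet). -/
def UniformlyLengthens (z : m.variations) : Prop :=
  ∃ ε : ℝ, 0 < ε ∧
    (∀ g, g ≠ 1 → ε * m.closedLength g ≤ m.dClosedLength g z) ∧
    (∀ c : m.Connection, 0 < m.connLength c → ε * m.connLength c ≤ m.dConnLength c z) ∧
    (∀ c : m.Connection, m.connLength c ≤ 0 → ε ≤ m.dConnLength c z)

/-- The admissible cone: the classes of the variations that uniformly lengthen all closed geodesics
and horoball connections. Trivial variations do not change any length, so the choice of the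
representative of a class is immaterial. -/
def admissibleCone : Set m.TangentSpace :=
  {w | ∃ z : m.variations, Submodule.Quotient.mk z = w ∧ m.UniformlyLengthens z}

end DecoratedMetric

end DecoratedSurface

end

noncomputable section
namespace DecoratedSurface

/-! ### Minkowski geometry -/

/-! Each length derivative is linear in the variation, so sums and positive multiples of uniformly
lengthening variations are uniformly lengthening. The real content is openness. It follows from
bounds `|dl_γ(z)| ≤ C‖z‖ l_γ` for closed geodesics (`exists_abs_dClosedLength_le`) and `|dl_β(z)| ≤
C‖z‖ (l_β + E)` for connections (`exists_abs_dConnLength_le`). Here `‖z‖` is a continuous quantity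
built from finitely many values of the cocycle and from the spike variations. A small perturbation
then costs at most half of `ε`. The constant `E` is harmless because positive connection lengths are
bounded below (`exists_connLength_ge`).

Both bounds come from `abs_mink_cocycle_le`. A geodesic segment in a convex core is halved until its
pieces have length at most 1. By the cocycle rule, the increment over a piece is a conjugate of the
value at one of the finitely many elements of small displacement. Paired with light-like `e`, `f`,
it is at most a constant times the product `⟨x,e⟩⟨x,f⟩` at a point `x` of the piece.

For a closed geodesic, `e` and `f` are the ends of the axis, the derivative is `-2⟨f, u(g)e⟩`, and
the product is constant on the axis. For a connection, the segment runs from a point `o` to `ρ(g)o`,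
and the product is at most a multiple of the entry `ρ(g)₂₂`, whose logarithm controls the segment
length. Since spikes avoid the limit set, `-⟨v_i, ρ(g)v_j⟩` is at least a multiple of that entry
(`exists_connection_ge`), so dividing by it leaves only the logarithm, which is comparable to the
length. -/

lemma mink_comm (x y : Mink) : mink x y = mink y x := by simp only [mink]; ring

lemma mink_add_left (x y z : Mink) : mink (x + y) z = mink x z + mink y z := by
  simp only [mink, Pi.add_apply]; ring

lemma mink_add_right (x y z : Mink) : mink x (y + z) = mink x y + mink x z := by
  simp only [mink, Pi.add_apply]; ring

lemma mink_sub_right (x y z : Mink) : mink x (y - z) = mink x y - mink x z := by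
  simp only [mink, Pi.sub_apply]; ring

lemma mink_sub_left (x y z : Mink) : mink (x - y) z = mink x z - mink y z := by
  simp only [mink, Pi.sub_apply]; ring

lemma mink_smul_left (c : ℝ) (x y : Mink) : mink (c • x) y = c * mink x y := by
  simp only [mink, Pi.smul_apply, smul_eq_mul]; ring

lemma mink_smul_right (c : ℝ) (x y : Mink) : mink x (c • y) = c * mink x y := by
  simp only [mink, Pi.smul_apply, smul_eq_mul]; ring

lemma mink_neg_left (x y : Mink) : mink (-x) y = -mink x y := by
  simp only [mink, Pi.neg_apply]; ring

/-- The closed future cone. -/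
def futureCausal : Set Mink := {f | mink f f ≤ 0 ∧ 0 ≤ f 2}

lemma hypPlane_subset_futureCausal : hypPlane ⊆ futureCausal := fun x hx =>
  ⟨by have := hx.1; linarith, hx.2.le⟩

lemma futureLight_subset_futureCausal : futureLight ⊆ futureCausal := fun _ hx =>
  ⟨hx.1.le, hx.2.le⟩

lemma abs_apply_le_of_futureCausal {f : Mink} (hf : f ∈ futureCausal) (i : Fin 3) :
    |f i| ≤ f 2 := by
  obtain ⟨h1, h2⟩ := hf
  simp only [mink] at h1
  fin_cases i
  · exact abs_le_of_sq_le_sq (by simp; nlinarith [sq_nonneg (f 1)]) h2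
  · exact abs_le_of_sq_le_sq (by simp; nlinarith [sq_nonneg (f 0)]) h2
  · simp [abs_of_nonneg h2]

/-- A reversed Cauchy–Schwarz estimate in coordinates. -/
lemma planar_sq_le {f h : Mink} : (f 0 * h 0 + f 1 * h 1) ^ 2 ≤
    (f 0 ^ 2 + f 1 ^ 2) * (h 0 ^ 2 + h 1 ^ 2) := by
  nlinarith [sq_nonneg (f 0 * h 1 - f 1 * h 0)]

lemma abs_planar_le {f h : Mink} (hf : f ∈ futureCausal) (hh : h ∈ futureCausal) :
    |f 0 * h 0 + f 1 * h 1| ≤ f 2 * h 2 := by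
  obtain ⟨h1, h2⟩ := hf
  obtain ⟨h3, h4⟩ := hh
  simp only [mink] at h1 h3
  refine abs_le_of_sq_le_sq (planar_sq_le.trans ?_) (mul_nonneg h2 h4)
  rw [mul_pow]
  exact mul_le_mul (by linarith) (by linarith) (by positivity) (by positivity)

lemma neg_mink_nonneg {f h : Mink} (hf : f ∈ futureCausal) (hh : h ∈ futureCausal) :
    0 ≤ -mink f h := by
  have := (abs_le.1 (abs_planar_le hf hh)).2
  simp only [mink]; linarith

lemma neg_mink_le {f h : Mink} (hf : f ∈ futureCausal) (hh : h ∈ futureCausal) :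
    -mink f h ≤ 2 * (f 2 * h 2) := by
  have := (abs_le.1 (abs_planar_le hf hh)).1
  simp only [mink]; linarith

/-- The time coordinate is the product with the base point up to sign, so this is the cost of
replacing the base point by `y`. -/
lemma apply_two_le {y f : Mink} (hy : y ∈ hypPlane) (hf : f ∈ futureCausal) :
    f 2 ≤ 2 * y 2 * -mink y f := by
  obtain ⟨h1, h2⟩ := hy
  obtain ⟨h3, h4⟩ := hf
  simp only [mink] at *
  -- Squaring reduces this to `4s²(s² - 1) ≤ (2s² - 1)²` with `s = y 2`; the two sides differ by 1.
  have key : 2 * y 2 * (y 0 * f 0 + y 1 * f 1) ≤ (2 * y 2 ^ 2 - 1) * f 2 := by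
    refine abs_le_of_sq_le_sq' ?_ (mul_nonneg ?_ h4) |>.2
    · have e1 : y 0 ^ 2 + y 1 ^ 2 = y 2 ^ 2 - 1 := by linarith
      have e2 : f 0 ^ 2 + f 1 ^ 2 ≤ f 2 ^ 2 := by linarith
      have e3 := planar_sq_le (f := y) (h := f)
      rw [e1] at e3
      have e4 : (y 2 ^ 2 - 1) * (f 0 ^ 2 + f 1 ^ 2) ≤ (y 2 ^ 2 - 1) * f 2 ^ 2 :=
        mul_le_mul_of_nonneg_left e2 (by nlinarith)
      have e5 : 4 * y 2 ^ 2 * (y 0 * f 0 + y 1 * f 1) ^ 2 ≤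
          4 * y 2 ^ 2 * ((y 2 ^ 2 - 1) * f 2 ^ 2) :=
        mul_le_mul_of_nonneg_left (e3.trans e4) (by positivity)
      nlinarith [sq_nonneg (f 2)]
    · nlinarith [sq_nonneg (y 0), sq_nonneg (y 1)]
  nlinarith

lemma one_le_apply_two {y : Mink} (hy : y ∈ hypPlane) : 1 ≤ y 2 := by
  obtain ⟨h1, h2⟩ := hy
  simp only [mink] at *
  nlinarith [sq_nonneg (y 0), sq_nonneg (y 1)]

/-- The orthogonal complement of a time-like vector is positive definite. -/
lemma eq_zero_of_orthogonal {y w : Mink} (hy : y ∈ hypPlane) (h : mink w y = 0)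
    (hw : mink w w ≤ 0) : w = 0 := by
  obtain ⟨h1, h2⟩ := hy
  simp only [mink] at *
  have e1 : y 0 ^ 2 + y 1 ^ 2 = y 2 ^ 2 - 1 := by linarith
  have e2 : w 0 ^ 2 + w 1 ^ 2 ≤ w 2 ^ 2 := by linarith
  have e3 := planar_sq_le (f := y) (h := w)
  rw [e1] at e3
  have e4 : (y 2 ^ 2 - 1) * (w 0 ^ 2 + w 1 ^ 2) ≤ (y 2 ^ 2 - 1) * w 2 ^ 2 :=
    mul_le_mul_of_nonneg_left e2 (by nlinarith [sq_nonneg (y 0), sq_nonneg (y 1)])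
  have e5 : y 0 * w 0 + y 1 * w 1 = y 2 * w 2 := by linarith
  rw [e5] at e3
  have e6 : w 2 = 0 := by
    have : w 2 ^ 2 ≤ 0 := by nlinarith
    nlinarith
  rw [e6] at e2
  have e7 : w 0 = 0 := by nlinarith [sq_nonneg (w 0), sq_nonneg (w 1)]
  have e8 : w 1 = 0 := by nlinarith [sq_nonneg (w 0), sq_nonneg (w 1)]
  ext i; fin_cases i <;> assumption

lemma one_le_neg_mink {x y : Mink} (hx : x ∈ hypPlane) (hy : y ∈ hypPlane) :
    1 ≤ -mink x y := by
  have h0 := neg_mink_nonneg (hypPlane_subset_futureCausal hx) (hypPlane_subset_futureCausal hy)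
  by_contra! h
  have h1 : mink (x + mink x y • y) y = 0 := by
    rw [mink_add_left, mink_smul_left, hy.1]; ring
  have h2 : mink (x + mink x y • y) (x + mink x y • y) = mink x y ^ 2 - 1 := by
    simp only [mink_add_left, mink_smul_left, mink_add_right, mink_smul_right, hy.1, hx.1,
      mink_comm y x]
    ring
  have h3 := eq_zero_of_orthogonal hy h1 (by rw [h2]; nlinarith)
  have h4 : mink 0 0 = 0 := by simp [mink]
  rw [h3, h4] at h2
  nlinarith

lemma eq_of_neg_mink_eq_one {x y : Mink} (hx : x ∈ hypPlane) (hy : y ∈ hypPlane)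
    (h : -mink x y = 1) : x = y := by
  have h' : mink x y = -1 := by linarith
  refine sub_eq_zero.1 (eq_zero_of_orthogonal hy ?_ ?_)
  · rw [mink_sub_left, hy.1, h']; ring
  · simp only [mink_sub_left, mink_sub_right, hx.1, hy.1, mink_comm y x, h']; norm_num

/-- If `w` were not future-pointing, `-w` would be causal and its product with `y` would have the
wrong sign. -/
lemma futureLight_of_neg_mink_pos {y w : Mink} (hy : y ∈ hypPlane) (hw : mink w w = 0)
    (h : 0 < -mink y w) : w ∈ futureLight := by
  refine ⟨hw, ?_⟩
  by_contra! h2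
  have := apply_two_le hy (f := -w) ⟨by simpa [mink] using hw.le, by simpa using h2⟩
  have e : mink y (-w) = -mink y w := by simp only [mink, Pi.neg_apply]; ring
  rw [e] at this
  simp only [Pi.neg_apply] at this
  nlinarith [hy.2, mul_pos hy.2 h]

/-- Two light-like vectors that are orthogonal are proportional. -/
lemma exists_smul_of_mink_eq_zero {v w : Mink} (hv : v ∈ futureLight) (hw : w ∈ futureLight)
    (h : mink v w = 0) : v = (v 2 / w 2) • w := by
  obtain ⟨h1, h2⟩ := hv
  obtain ⟨h3, h4⟩ := hw
  simp only [mink] at *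
  have e : (v 0 * w 2 - v 2 * w 0) ^ 2 + (v 1 * w 2 - v 2 * w 1) ^ 2 = 0 := by
    linear_combination w 2 ^ 2 * h1 + v 2 ^ 2 * h3 - 2 * v 2 * w 2 * h
  have e1 : v 0 * w 2 - v 2 * w 0 = 0 := by
    nlinarith [sq_nonneg (v 0 * w 2 - v 2 * w 0), sq_nonneg (v 1 * w 2 - v 2 * w 1)]
  have e2 : v 1 * w 2 - v 2 * w 1 = 0 := by
    nlinarith [sq_nonneg (v 0 * w 2 - v 2 * w 0), sq_nonneg (v 1 * w 2 - v 2 * w 1)]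
  ext i
  fin_cases i <;> simp <;> field_simp <;> linarith

lemma abs_mink_le (a : Mink) {w : Mink} (hw : w ∈ futureCausal) :
    |mink a w| ≤ 3 * ‖a‖ * w 2 := by
  have h (i : Fin 3) : |a i * w i| ≤ ‖a‖ * w 2 := by
    rw [abs_mul]
    exact mul_le_mul (norm_le_pi_norm a i) (abs_apply_le_of_futureCausal hw i) (abs_nonneg _)
      (norm_nonneg _)
  have h0 := abs_le.1 (h 0)
  have h1 := abs_le.1 (h 1)
  have h2 := abs_le.1 (h 2)
  simp only [mink]
  exact abs_le.2 ⟨by linarith, by linarith⟩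

/-- The sum of the absolute values of the entries of a matrix. -/
def entrySum (U : Mat3) : ℝ := ∑ i, ∑ j, |U i j|

lemma entrySum_nonneg (U : Mat3) : 0 ≤ entrySum U :=
  Finset.sum_nonneg fun _ _ => Finset.sum_nonneg fun _ _ => abs_nonneg _

lemma abs_mink_mulVec_le (U : Mat3) {f h : Mink} (hf : f ∈ futureCausal) (hh : h ∈ futureCausal) :
    |mink f (U *ᵥ h)| ≤ entrySum U * (f 2 * h 2) := by
  have k (i j : Fin 3) : |f i * U i j * h j| ≤ |U i j| * (f 2 * h 2) := by
    rw [abs_mul, abs_mul, mul_comm |f i|, mul_assoc]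
    exact mul_le_mul_of_nonneg_left (mul_le_mul (abs_apply_le_of_futureCausal hf i)
      (abs_apply_le_of_futureCausal hh j) (abs_nonneg _) hf.2) (abs_nonneg _)
  have e : mink f (U *ᵥ h) = ∑ i, ∑ j, (![1, 1, -1] : Fin 3 → ℝ) i * (f i * U i j * h j) := by
    simp [mink, Matrix.mulVec, dotProduct, Fin.sum_univ_three]; ring
  rw [e, entrySum, Finset.sum_mul]
  refine (Finset.abs_sum_le_sum_abs _ _).trans (Finset.sum_le_sum fun i _ => ?_)
  rw [Finset.sum_mul]
  refine (Finset.abs_sum_le_sum_abs _ _).trans (Finset.sum_le_sum fun j _ => ?_)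
  refine le_trans (le_of_eq ?_) (k i j)
  rw [abs_mul]
  fin_cases i <;> simp

/-- The base point of the hyperboloid. -/
abbrev basePoint : Mink := ![0, 0, 1]

lemma basePoint_mem : basePoint ∈ hypPlane := by simp [hypPlane, mink]

lemma mink_basePoint_left (x : Mink) : -mink basePoint x = x 2 := by simp [mink]

lemma mink_basePoint_right (x : Mink) : -mink x basePoint = x 2 := by simp [mink]

/-! ### Lorentz transformations -/

section Isom

variable (A : isomGroup)

/-- The matrix of an isometry. -/
abbrev isomMat (A : isomGroup) : Mat3 := ((A : (Mat3)ˣ) : Mat3)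

lemma mink_isom (x y : Mink) : mink (isomMat A *ᵥ x) (isomMat A *ᵥ y) = mink x y := A.2.1 x y

lemma isom_mulVec_inv (x : Mink) : isomMat A *ᵥ isomMat A⁻¹ *ᵥ x = x := by
  simp [isomMat, Matrix.mulVec_mulVec]

lemma mink_isom_inv_left (x y : Mink) : mink (isomMat A⁻¹ *ᵥ x) y = mink x (isomMat A *ᵥ y) := by
  rw [← mink_isom A, isom_mulVec_inv]

lemma isom_hypPlane {x : Mink} (hx : x ∈ hypPlane) : isomMat A *ᵥ x ∈ hypPlane := (A.2.2 x).2 hx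

lemma isom_futureLight {x : Mink} (hx : x ∈ futureLight) : isomMat A *ᵥ x ∈ futureLight := by
  refine futureLight_of_neg_mink_pos (isom_hypPlane A basePoint_mem) ?_ ?_
  · rw [mink_isom]; exact hx.1
  · rw [mink_isom, mink_basePoint_left]; exact hx.2

lemma isom_basePoint_two : (isomMat A *ᵥ basePoint) 2 = isomMat A 2 2 := by
  simp [Matrix.mulVec, dotProduct, Fin.sum_univ_three]

/-- The last diagonal entry is the hyperbolic cosine of the displacement of the base point; it
serves throughout as the size of a group element. -/
lemma neg_mink_basePoint_isom : -mink basePoint (isomMat A *ᵥ basePoint) = isomMat A 2 2 := by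
  rw [mink_basePoint_left, isom_basePoint_two]

lemma one_le_isom_two_two : 1 ≤ isomMat A 2 2 := by
  rw [← isom_basePoint_two]; exact one_le_apply_two (isom_hypPlane A basePoint_mem)

lemma isom_inv_two_two : isomMat A⁻¹ 2 2 = isomMat A 2 2 := by
  rw [← neg_mink_basePoint_isom, ← neg_mink_basePoint_isom, mink_comm, mink_isom_inv_left]

/-- The time coordinate of an isometry is controlled by the displacement between two points. -/
lemma isom_two_two_le {y y' : Mink} (hy : y ∈ hypPlane) (hy' : y' ∈ hypPlane) :
    isomMat A 2 2 ≤ 4 * (y 2 * y' 2) * -mink y (isomMat A *ᵥ y') := by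
  have h1 := apply_two_le hy (hypPlane_subset_futureCausal (isom_hypPlane A hy'))
  have h2 := apply_two_le hy' (hypPlane_subset_futureCausal (isom_hypPlane A⁻¹ basePoint_mem))
  rw [isom_basePoint_two, isom_inv_two_two, mink_comm, mink_isom_inv_left,
    mink_basePoint_left] at h2
  nlinarith [mul_le_mul_of_nonneg_left h1 (by linarith [hy'.2] : 0 ≤ 2 * y' 2)]

/-- The entries of an isometry are controlled by the time coordinate. -/
lemma isom_entry_le (i j : Fin 3) : |isomMat A i j| ≤ isomMat A 2 2 * 3 := by
  have hlast (A : isomGroup) (i : Fin 3) : |isomMat A i 2| ≤ isomMat A 2 2 := by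
    have := abs_apply_le_of_futureCausal (hypPlane_subset_futureCausal
      (isom_hypPlane A basePoint_mem)) i
    rw [isom_basePoint_two] at this
    simpa [Matrix.mulVec, dotProduct, Fin.sum_univ_three] using this
  have hpos := one_le_isom_two_two A
  -- Up to sign, the last row of `A` is the last column of its inverse.
  have hrow (j : Fin 3) : |isomMat A 2 j| ≤ isomMat A 2 2 := by
    have h1 := mink_isom_inv_left A basePoint (Pi.single j 1)
    have h2 := hlast A⁻¹ j
    rw [isom_inv_two_two] at h2
    have h3 : mink basePoint (isomMat A *ᵥ Pi.single j 1) = - isomMat A 2 j := by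
      simp [mink]
    have h4 : |mink (isomMat A⁻¹ *ᵥ basePoint) (Pi.single j 1)| = |isomMat A⁻¹ j 2| := by
      simp only [mink, Matrix.mulVec, dotProduct, Fin.sum_univ_three]
      fin_cases j <;> simp
    rw [← h4, h1, h3, abs_neg] at h2
    exact h2
  -- A column has Minkowski square at most 1, so its last entry controls the other two.
  have hcol := mink_isom A (Pi.single j 1) (Pi.single j 1)
  have hle : mink (Pi.single j 1) (Pi.single j 1) ≤ 1 := by
    simp only [mink]; fin_cases j <;> simp
  rw [← hcol] at hle
  simp only [mink, Matrix.mulVec_single_one, Matrix.col_apply] at hle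
  have h2 := abs_le.1 (hrow j)
  have h3 : isomMat A 2 j ^ 2 ≤ isomMat A 2 2 ^ 2 := sq_le_sq' h2.1 h2.2
  refine abs_le_of_sq_le_sq ?_ (by linarith)
  have hall : isomMat A 0 j ^ 2 + isomMat A 1 j ^ 2 + isomMat A 2 j ^ 2 ≤
    (isomMat A 2 2 * 3) ^ 2 := by nlinarith
  fin_cases i <;> simp only [Fin.zero_eta, Fin.mk_one, Fin.reduceFinMk] <;>
    nlinarith [sq_nonneg (isomMat A 0 j), sq_nonneg (isomMat A 1 j), sq_nonneg (isomMat A 2 j)]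

end Isom

namespace DecoratedMetric
open Filter Topology

variable {r Q : ℕ} (m : DecoratedMetric r Q)

/-! ### Holonomy and finiteness -/

lemma hol_one : m.hol 1 = 1 := by simp [hol]

lemma hol_mul (g h : FreeGroup (Fin r)) : m.hol (g * h) = m.hol g * m.hol h := by simp [hol]

lemma hol_mul_mulVec (g h : FreeGroup (Fin r)) (x : Mink) :
    m.hol (g * h) *ᵥ x = m.hol g *ᵥ m.hol h *ᵥ x := by
  rw [hol_mul, Matrix.mulVec_mulVec]

lemma hol_inv_mul (g : FreeGroup (Fin r)) : m.hol g⁻¹ * m.hol g = 1 := by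
  rw [← hol_mul, inv_mul_cancel, hol_one]

lemma hol_mul_inv (g : FreeGroup (Fin r)) : m.hol g * m.hol g⁻¹ = 1 := by
  rw [← hol_mul, mul_inv_cancel, hol_one]

lemma hol_inv_eq (g : FreeGroup (Fin r)) : m.hol g⁻¹ = isomMat (m.ρ g)⁻¹ := by
  rw [← map_inv]; rfl

lemma mink_hol (g : FreeGroup (Fin r)) (x y : Mink) :
    mink (m.hol g *ᵥ x) (m.hol g *ᵥ y) = mink x y := mink_isom (m.ρ g) x y

lemma hol_inv_mulVec (g : FreeGroup (Fin r)) (x : Mink) : m.hol g⁻¹ *ᵥ m.hol g *ᵥ x = x := by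
  rw [Matrix.mulVec_mulVec, hol_inv_mul, Matrix.one_mulVec]

lemma hol_mulVec_inv (g : FreeGroup (Fin r)) (x : Mink) : m.hol g *ᵥ m.hol g⁻¹ *ᵥ x = x := by
  rw [Matrix.mulVec_mulVec, hol_mul_inv, Matrix.one_mulVec]

lemma mink_hol_inv_left (g : FreeGroup (Fin r)) (x y : Mink) :
    mink (m.hol g⁻¹ *ᵥ x) y = mink x (m.hol g *ᵥ y) := by
  rw [← m.mink_hol g, hol_mulVec_inv]

lemma hol_hypPlane (g : FreeGroup (Fin r)) {x : Mink} (hx : x ∈ hypPlane) :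
    m.hol g *ᵥ x ∈ hypPlane := isom_hypPlane _ hx

lemma hol_futureLight (g : FreeGroup (Fin r)) {x : Mink} (hx : x ∈ futureLight) :
    m.hol g *ᵥ x ∈ futureLight := isom_futureLight _ hx

lemma one_le_hol_two_two (g : FreeGroup (Fin r)) : 1 ≤ m.hol g 2 2 := one_le_isom_two_two _

lemma hol_inv_two_two (g : FreeGroup (Fin r)) : m.hol g⁻¹ 2 2 = m.hol g 2 2 := by
  rw [hol_inv_eq]; exact isom_inv_two_two _

/-- Elements of bounded size have bounded entries, so an infinite family has a convergent
subsequence. Its consecutive quotients tend to 1, hence equal 1 eventually by discreteness, against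
injectivity. -/
lemma finite_hol_two_two_le (T : ℝ) : {g | m.hol g 2 2 ≤ T}.Finite := by
  by_contra hinf
  let f := Set.Infinite.natEmbedding _ hinf
  have hf (n : ℕ) : m.hol (f n) 2 2 ≤ T := (f n).2
  have hT : 0 ≤ T := zero_le_one.trans ((m.one_le_hol_two_two _).trans (hf 0))
  -- Inverses must converge too, since the topology on units is induced by the pair of a unit and
  -- its inverse.
  obtain ⟨a, b, φ, hφ, ha, hbb⟩ : ∃ a b : Mat3, ∃ φ : ℕ → ℕ, StrictMono φ ∧
      Tendsto (fun n => m.hol (f (φ n))) atTop (𝓝 a) ∧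
      Tendsto (fun n => m.hol (f (φ n) : FreeGroup (Fin r))⁻¹) atTop (𝓝 b) := by
    let u : ℕ → (Fin 3 → Fin 3 → ℝ) × (Fin 3 → Fin 3 → ℝ) := fun n =>
      (Matrix.of.symm (m.hol (f n)), Matrix.of.symm (m.hol (f n : FreeGroup (Fin r))⁻¹))
    have hb : Bornology.IsBounded (Set.range u) := by
      refine isBounded_iff_forall_norm_le.2 ⟨T * 3, ?_⟩
      rintro _ ⟨n, rfl⟩
      have hn (g : FreeGroup (Fin r)) (hg : m.hol g 2 2 ≤ T) :
          ‖Matrix.of.symm (m.hol g)‖ ≤ T * 3 := by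
        refine (pi_norm_le_iff_of_nonneg (by positivity)).2 fun i =>
          (pi_norm_le_iff_of_nonneg (by positivity)).2 fun j => ?_
        exact (isom_entry_le (m.ρ g) i j).trans (mul_le_mul_of_nonneg_right hg (by norm_num))
      exact norm_prod_le_iff.2 ⟨hn _ (hf n), hn _ (by rw [hol_inv_two_two]; exact hf n)⟩
    obtain ⟨⟨a, b⟩, -, φ, hφ, hlim⟩ :=
      tendsto_subseq_of_bounded hb (fun n => Set.mem_range_self n)
    exact ⟨a, b, φ, hφ, (continuous_fst.tendsto _).comp hlim, (continuous_snd.tendsto _).comp hlim⟩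
  have hba : b * a = 1 := by
    refine tendsto_nhds_unique (hbb.mul ha) ?_
    simp only [hol_inv_mul]
    exact tendsto_const_nhds
  have ha' := ha.comp (tendsto_add_atTop_nat 1)
  have hbb' := hbb.comp (tendsto_add_atTop_nat 1)
  let h : ℕ → FreeGroup (Fin r) := fun n =>
    (f (φ n) : FreeGroup (Fin r))⁻¹ * f (φ (n + 1))
  have h1 : Tendsto (fun n => m.hol (h n)) atTop (𝓝 1) := by
    simp only [h, hol_mul]; rw [← hba]; exact hbb.mul ha'
  have h2 : Tendsto (fun n => m.hol (h n)⁻¹) atTop (𝓝 1) := by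
    simp only [h, mul_inv_rev, inv_inv, hol_mul]; rw [← hba]; exact hbb'.mul ha
  have h3 : Tendsto (fun n => (m.ρ (h n) : (Mat3)ˣ)) atTop (𝓝 1) := by
    rw [Units.isInducing_embedProduct.tendsto_nhds_iff]
    refine Tendsto.prodMk_nhds h1 ?_
    refine (MulOpposite.continuous_op.tendsto _).comp (h2.congr fun n => ?_)
    simp [hol]
  have h4 : Tendsto (fun n => (⟨m.ρ (h n), h n, rfl⟩ : m.ρ.range)) atTop (𝓝 1) := by
    rw [tendsto_subtype_rng, tendsto_subtype_rng]; exact h3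
  have := m.discrete
  rw [nhds_discrete, tendsto_pure] at h4
  obtain ⟨n, hn⟩ := h4.exists
  have h5 : m.ρ (h n) = 1 := congrArg Subtype.val hn
  have h6 : h n = 1 := m.faithful (h5.trans (map_one _).symm)
  have h7 : f (φ n) = f (φ (n + 1)) := Subtype.ext (inv_mul_eq_one.1 h6)
  exact (hφ n.lt_succ_self).ne (f.injective h7)

/-- The powers of a non-trivial element have unbounded holonomy. -/
lemma exists_pow_two_two_gt {g : FreeGroup (Fin r)} (hg : g ≠ 1) (T : ℝ) :
    ∃ n : ℕ, T < m.hol (g ^ n) 2 2 := by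
  by_contra! h
  have : Function.Injective fun n : ℕ => g ^ n := IsMulTorsionFree.pow_right_injective hg
  exact Set.infinite_of_injective_forall_mem this h (m.finite_hol_two_two_le T)

end DecoratedMetric

/-- The midpoint of two points of the hyperbolic plane. -/
lemma exists_midpoint {x y : Mink} (hx : x ∈ hypPlane) (hy : y ∈ hypPlane) :
    ∃ a : ℝ, 0 < a ∧ a ^ 2 * (2 + 2 * -mink x y) = 1 ∧ a • x + a • y ∈ hypPlane := by
  have h := one_le_neg_mink hx hy
  have hpos : 0 < 2 + 2 * -mink x y := by linarith
  have ha : (√(2 + 2 * -mink x y))⁻¹ ^ 2 * (2 + 2 * -mink x y) = 1 := by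
    rw [inv_pow, Real.sq_sqrt hpos.le, inv_mul_cancel₀ hpos.ne']
  have hp : 0 < (√(2 + 2 * -mink x y))⁻¹ := by positivity
  refine ⟨_, hp, ha, ?_, ?_⟩
  · simp only [mink_add_left, mink_add_right, mink_smul_left, mink_smul_right, hx.1, hy.1,
      mink_comm y x]
    linear_combination -ha
  · have := hx.2
    have := hy.2
    simp only [Pi.add_apply, Pi.smul_apply, smul_eq_mul]
    positivity

namespace DecoratedMetric

variable {r Q : ℕ} (m : DecoratedMetric r Q)

/-! ### Convex cores -/

/-- A convex set with cocompact action of the fundamental group, with a bounded fundamental set. -/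
structure Core where
  carrier : Set Mink
  subset : carrier ⊆ hypPlane
  convex : ∀ x ∈ carrier, ∀ y ∈ carrier, ∀ a b : ℝ, 0 ≤ a → 0 ≤ b →
      a • x + b • y ∈ hypPlane → a • x + b • y ∈ carrier
  invariant : ∀ g, ∀ x ∈ carrier, m.hol g *ᵥ x ∈ carrier
  fund : Set Mink
  fund_subset : fund ⊆ carrier
  compact : IsCompact fund
  cover : ∀ x ∈ carrier, ∃ g, ∃ y ∈ fund, x = m.hol g *ᵥ y
  origin : Mink
  origin_mem : origin ∈ fund
  radius : ℝ
  le_radius : ∀ y ∈ fund, y 2 ≤ radius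

lemma nonempty_core : Nonempty m.Core := by
  obtain ⟨C, h1, ⟨x, hx⟩, -, h4, h5, K, hK, hKc, hcov⟩ := m.convex_cocompact
  obtain ⟨-, o, ho, -⟩ := hcov x hx
  obtain ⟨R, hR⟩ := (hKc.image (continuous_apply (2 : Fin 3))).bddAbove
  exact ⟨⟨C, h1, h4, h5, K, hK, hKc, hcov, o, ho, R, fun y hy => hR (Set.mem_image_of_mem _ hy)⟩⟩

variable {m}

namespace Core

variable (D : m.Core)

lemma fund_hyp {y : Mink} (hy : y ∈ D.fund) : y ∈ hypPlane := D.subset (D.fund_subset hy)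

lemma one_le_radius : 1 ≤ D.radius :=
  (one_le_apply_two (D.fund_hyp D.origin_mem)).trans (D.le_radius _ D.origin_mem)

lemma radius_pos : 0 < D.radius := zero_lt_one.trans_le D.one_le_radius

lemma hol_two_two_le {y y' : Mink} (hy : y ∈ D.fund) (hy' : y' ∈ D.fund)
    (g : FreeGroup (Fin r)) :
    m.hol g 2 2 ≤ 4 * D.radius ^ 2 * -mink y (m.hol g *ᵥ y') := by
  have h1 := isom_two_two_le (m.ρ g) (D.fund_hyp hy) (D.fund_hyp hy')
  have h2 := one_le_neg_mink (D.fund_hyp hy) (m.hol_hypPlane g (D.fund_hyp hy'))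
  refine h1.trans (mul_le_mul_of_nonneg_right ?_ (zero_le_one.trans h2))
  have := mul_le_mul (D.le_radius y hy) (D.le_radius y' hy') (D.fund_hyp hy').2.le D.radius_pos.le
  nlinarith

lemma apply_two_le {y f : Mink} (hy : y ∈ D.fund) (hf : f ∈ futureCausal) :
    f 2 ≤ 2 * D.radius * -mink y f := by
  refine (DecoratedSurface.apply_two_le (D.fund_hyp hy) hf).trans ?_
  refine mul_le_mul_of_nonneg_right ?_
    (neg_mink_nonneg (hypPlane_subset_futureCausal (D.fund_hyp hy)) hf)
  linarith [D.le_radius y hy]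

/-- The finitely many elements with displacement at most `T` between points of the fundamental
set. -/
def near (T : ℝ) : Finset (FreeGroup (Fin r)) :=
  (m.finite_hol_two_two_le (4 * D.radius ^ 2 * T)).toFinset

lemma mem_near {T : ℝ} {y y' : Mink} (hy : y ∈ D.fund) (hy' : y' ∈ D.fund)
    {g : FreeGroup (Fin r)} (h : -mink y (m.hol g *ᵥ y') ≤ T) : g ∈ D.near T := by
  simp only [near, Set.Finite.mem_toFinset, Set.mem_ofPred_eq]
  exact (D.hol_two_two_le hy hy' g).trans (mul_le_mul_of_nonneg_left h (by positivity))

/-! ### Cocycle increments along geodesic segments -/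

/-- The size of a variation on the elements of small displacement. -/
def size (z : m.variations) : ℝ := ∑ s ∈ D.near (Real.cosh 1), entrySum (z.1.1 s)

lemma size_nonneg (z : m.variations) : 0 ≤ D.size z :=
  Finset.sum_nonneg fun _ _ => entrySum_nonneg _

lemma cocycle (z : m.variations) (g h : FreeGroup (Fin r)) :
    z.1.1 (g * h) = z.1.1 g + m.hol g * z.1.1 h * m.hol g⁻¹ := z.2.2.1 g h

lemma mink_conj (X : Mat3) (g : FreeGroup (Fin r)) (e f : Mink) :
    mink e ((m.hol g * X * m.hol g⁻¹) *ᵥ f) =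
      mink (m.hol g⁻¹ *ᵥ e) (X *ᵥ m.hol g⁻¹ *ᵥ f) := by
  rw [mink_hol_inv_left, Matrix.mulVec_mulVec, Matrix.mulVec_mulVec, mul_assoc]

/-- The variation of a cocycle along a segment, paired with the end points of a geodesic that
stays close to the segment, is bounded linearly in the length of the segment. -/
lemma abs_mink_cocycle_le (z : m.variations) {e f : Mink} (he : e ∈ futureLight)
    (hf : f ∈ futureLight) (B : ℝ) (n : ℕ) : ∀ x ∈ D.carrier, ∀ x' ∈ D.carrier, ∀ γ γ',
    ∀ y ∈ D.fund, ∀ y' ∈ D.fund, x = m.hol γ *ᵥ y → x' = m.hol γ' *ᵥ y' →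
    -mink x x' ≤ Real.cosh (2 ^ n) →
    (∀ a b : ℝ, 0 ≤ a → 0 ≤ b → a • x + b • x' ∈ hypPlane →
      mink (a • x + b • x') e * mink (a • x + b • x') f ≤ B) →
    |mink e ((z.1.1 γ' - z.1.1 γ) *ᵥ f)| ≤ 2 ^ n * (4 * D.radius ^ 2 * D.size z * B) := by
  induction n with
  | zero =>
    intro x hx x' hx' γ γ' y hy y' hy' hxy hxy' hd hB
    -- Translating by `γ⁻¹` brings the short segment to the fundamental set, so `γ⁻¹ * γ'` is one of
    -- the near elements.
    have hs : -mink y (m.hol (γ⁻¹ * γ') *ᵥ y') ≤ Real.cosh 1 := by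
      rw [hol_mul_mulVec, ← hxy', mink_comm, mink_hol_inv_left, ← hxy, mink_comm]
      simpa using hd
    have hmem := D.mem_near hy hy' hs
    have heq : z.1.1 γ' - z.1.1 γ = m.hol γ * z.1.1 (γ⁻¹ * γ') * m.hol γ⁻¹ := by
      rw [sub_eq_iff_eq_add', ← cocycle, mul_inv_cancel_left]
    rw [heq, mink_conj, pow_zero, one_mul]
    have he' := futureLight_subset_futureCausal (m.hol_futureLight γ⁻¹ he)
    have hf' := futureLight_subset_futureCausal (m.hol_futureLight γ⁻¹ hf)
    refine (abs_mink_mulVec_le _ he' hf').trans ?_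
    have h1 := D.apply_two_le hy he'
    have h2 := D.apply_two_le hy hf'
    rw [mink_comm, mink_hol_inv_left, ← hxy, mink_comm] at h1 h2
    have hBx := hB 1 0 zero_le_one le_rfl (by simpa using D.subset hx)
    simp only [one_smul, zero_smul, add_zero] at hBx
    have h3 : entrySum (z.1.1 (γ⁻¹ * γ')) ≤ D.size z :=
      Finset.single_le_sum (f := fun s => entrySum (z.1.1 s))
        (fun _ _ => entrySum_nonneg _) hmem
    have h4 := mul_le_mul h1 h2 hf'.2 (he'.2.trans h1)
    calc _ ≤ D.size z * (4 * D.radius ^ 2 * B) := by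
          refine mul_le_mul h3 (h4.trans ?_) (mul_nonneg he'.2 hf'.2) (D.size_nonneg z)
          nlinarith [mul_le_mul_of_nonneg_left hBx (by positivity : 0 ≤ 4 * D.radius ^ 2)]
      _ = _ := by ring
  | succ n ih =>
    intro x hx x' hx' γ γ' y hy y' hy' hxy hxy' hd hB
    obtain ⟨a, ha, ha2, hm⟩ := exists_midpoint (D.subset hx) (D.subset hx')
    have hmC := D.convex x hx x' hx' a a ha.le ha.le hm
    obtain ⟨δ, w, hw, hwm⟩ := D.cover _ hmC
    have hc := one_le_neg_mink (D.subset hx) (D.subset hx')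
    rw [pow_succ, mul_comm, Real.cosh_two_mul, Real.sinh_sq] at hd
    -- `a * (1 + cosh d)` is `cosh (d / 2)`, the value for each half of the segment.
    have key : a * (1 + -mink x x') ≤ Real.cosh (2 ^ n) := by
      refine abs_le_of_sq_le_sq' ?_ (Real.cosh_pos _).le |>.2
      nlinarith
    have h1 := ih x hx _ hmC γ δ y hy w hw hxy hwm (by
      rw [mink_add_right, mink_smul_right, mink_smul_right, (D.subset hx).1]
      linarith) (fun b c hb hc hbc => by
        have e : b • x + c • (a • x + a • x') = (b + c * a) • x + (c * a) • x' := by module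
        rw [e] at hbc ⊢
        exact hB _ _ (by positivity) (by positivity) hbc)
    have h2 := ih _ hmC x' hx' δ γ' w hw y' hy' hwm hxy' (by
      rw [mink_add_left, mink_smul_left, mink_smul_left, (D.subset hx').1]
      linarith) (fun b c hb hc hbc => by
        have e : b • (a • x + a • x') + c • x' = (b * a) • x + (b * a + c) • x' := by module
        rw [e] at hbc ⊢
        exact hB _ _ (by positivity) (by positivity) hbc)
    have e : z.1.1 γ' - z.1.1 γ = (z.1.1 γ' - z.1.1 δ) + (z.1.1 δ - z.1.1 γ) := by abel
    rw [e, Matrix.add_mulVec, mink_add_right, pow_succ]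
    refine (abs_add_le _ _).trans ?_
    linarith

/-- The same estimate in terms of the length of the segment. -/
lemma abs_mink_cocycle_le_arcosh (z : m.variations) {e f : Mink} (he : e ∈ futureLight)
    (hf : f ∈ futureLight) (B : ℝ) {x x' : Mink} (hx : x ∈ D.carrier) (hx' : x' ∈ D.carrier)
    {γ γ' : FreeGroup (Fin r)} {y y' : Mink} (hy : y ∈ D.fund) (hy' : y' ∈ D.fund)
    (hxy : x = m.hol γ *ᵥ y) (hxy' : x' = m.hol γ' *ᵥ y')
    (hB : ∀ a b : ℝ, 0 ≤ a → 0 ≤ b → a • x + b • x' ∈ hypPlane →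
      mink (a • x + b • x') e * mink (a • x + b • x') f ≤ B) :
    |mink e ((z.1.1 γ' - z.1.1 γ) *ᵥ f)| ≤
      (2 * Real.arcosh (-mink x x') + 1) * (4 * D.radius ^ 2 * D.size z * B) := by
  have hc := one_le_neg_mink (D.subset hx) (D.subset hx')
  have hnn := Real.arcosh_nonneg hc
  -- A power of two within a factor two above the length; the `+ 1` covers segments shorter than 1,
  -- where `n = 0`.
  obtain ⟨n, hn, hn'⟩ : ∃ n : ℕ, Real.arcosh (-mink x x') ≤ 2 ^ n ∧
      (2 : ℝ) ^ n ≤ 2 * Real.arcosh (-mink x x') + 1 := by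
    rcases le_total (Real.arcosh (-mink x x')) 1 with h | h
    · exact ⟨0, by simpa using h, by simpa using hnn⟩
    · obtain ⟨n, h1, h2⟩ := exists_nat_pow_near h (one_lt_two)
      refine ⟨n + 1, h2.le, ?_⟩
      rw [pow_succ]; linarith
  have hB0 : 0 ≤ B := by
    have h := hB 1 0 zero_le_one le_rfl (by simpa using D.subset hx)
    simp only [one_smul, zero_smul, add_zero] at h
    have h1 := neg_mink_nonneg (hypPlane_subset_futureCausal (D.subset hx))
      (futureLight_subset_futureCausal he)
    have h2 := neg_mink_nonneg (hypPlane_subset_futureCausal (D.subset hx))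
      (futureLight_subset_futureCausal hf)
    nlinarith [mul_nonneg h1 h2]
  refine (D.abs_mink_cocycle_le z he hf B n x hx x' hx' γ γ' y hy y' hy' hxy hxy' ?_ hB).trans
    (mul_le_mul_of_nonneg_right hn' ?_)
  · rw [← Real.cosh_arcosh hc, Real.cosh_le_cosh, abs_of_nonneg hnn,
      abs_of_nonneg (by positivity)]
    exact hn
  · have := D.size_nonneg z
    positivity

end Core
end DecoratedMetric

/-! ### Traces and determinants in a null frame -/

/-- The unit normal of the plane spanned by two light-like vectors with product `-1/2`. -/
def nullNormal (e f : Mink) : Mink :=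
  ![2 * (e 1 * f 2 - e 2 * f 1), 2 * (e 2 * f 0 - e 0 * f 2), -2 * (e 0 * f 1 - e 1 * f 0)]

lemma mink_nullNormal_left (e f : Mink) : mink e (nullNormal e f) = 0 := by
  simp [mink, nullNormal]; ring

lemma mink_nullNormal_right (e f : Mink) : mink f (nullNormal e f) = 0 := by
  simp [mink, nullNormal]; ring

lemma mink_nullNormal_self (e f : Mink) :
    mink (nullNormal e f) (nullNormal e f) = 4 * (mink e f ^ 2 - mink e e * mink f f) := by
  simp [mink, nullNormal]; ring

/-- Pairing matrix of two families for a matrix. -/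
def pairing (d p : Fin 3 → Mink) (T : Mat3) : Mat3 := Matrix.of fun i j => mink (d i) (T *ᵥ p j)

lemma pairing_eq (d p : Fin 3 → Mink) (T : Mat3) :
    pairing d p T = (Matrix.of fun i j => d i j * (![1, 1, -1] : Mink) j) * T *
      (Matrix.of p)ᵀ := by
  ext i j
  simp [pairing, mink, Matrix.mul_apply, Matrix.mulVec, dotProduct, Fin.sum_univ_three]
  ring

/-- When `d` is dual to `p`, the pairing is the matrix of `T` in the basis `p`. -/
lemma trace_pairing {d p : Fin 3 → Mink} (h : pairing d p 1 = 1) (T : Mat3) :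
    (pairing d p T).trace = T.trace := by
  rw [pairing_eq, mul_one] at h
  rw [pairing_eq, mul_assoc, Matrix.trace_mul_comm, mul_assoc, mul_eq_one_comm.1 h, mul_one]

lemma det_pairing {d p : Fin 3 → Mink} (h : pairing d p 1 = 1) (T : Mat3) :
    (pairing d p T).det = T.det := by
  rw [pairing_eq, mul_one] at h
  rw [pairing_eq, Matrix.det_mul, Matrix.det_mul, mul_right_comm, ← Matrix.det_mul, h,
    Matrix.det_one, one_mul]

section NullFrame

variable {e f : Mink}

/-- Since `⟨e, f⟩ = -1/2`, the dual basis exchanges `e` and `f` with factor `-2`; the normal is a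
unit vector. -/
lemma pairing_one (he : mink e e = 0) (hf : mink f f = 0) (hef : mink e f = -1 / 2) :
    pairing ![(-2 : ℝ) • f, (-2 : ℝ) • e, nullNormal e f] ![e, f, nullNormal e f] 1 = 1 := by
  have h1 := mink_nullNormal_left e f
  have h2 := mink_nullNormal_right e f
  have h3 := mink_nullNormal_self e f
  have h4 : mink f e = -1 / 2 := by rw [mink_comm, hef]
  rw [he, hf, hef] at h3
  have h5 := mink_comm (nullNormal e f) e
  have h6 := mink_comm (nullNormal e f) f
  ext i j
  fin_cases i <;> fin_cases j <;>
    simp [pairing, mink_neg_left, mink_smul_left, *]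
  all_goals norm_num

/-- In the null frame `A` is diagonal with entries `a, b, s`, so trace minus determinant is `a + b +
s - abs = a + b` whatever the sign `s`: translations and glide reflections are treated alike. -/
lemma trace_sub_det (A : isomGroup) (he : mink e e = 0) (hf : mink f f = 0)
    (hef : mink e f = -1 / 2) {a b : ℝ} (hab : a * b = 1) (hAe : isomMat A *ᵥ e = a • e)
    (hAf : isomMat A *ᵥ f = b • f) : (isomMat A).trace - (isomMat A).det = a + b := by
  have h := pairing_one he hf hef
  have ha : a ≠ 0 := left_ne_zero_of_mul_eq_one hab
  have hb : b ≠ 0 := right_ne_zero_of_mul_eq_one hab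
  have h1 := mink_nullNormal_left e f
  have h2 := mink_nullNormal_right e f
  have h4 : mink f e = -1 / 2 := by rw [mink_comm, hef]
  have h5 := mink_comm (nullNormal e f) e
  have h6 := mink_comm (nullNormal e f) f
  have h7 : mink e (isomMat A *ᵥ nullNormal e f) = 0 := by
    have := mink_isom A e (nullNormal e f)
    rw [hAe, mink_smul_left, h1] at this
    exact (mul_eq_zero.1 this).resolve_left ha
  have h8 : mink f (isomMat A *ᵥ nullNormal e f) = 0 := by
    have := mink_isom A f (nullNormal e f)
    rw [hAf, mink_smul_left, h2] at this
    exact (mul_eq_zero.1 this).resolve_left hb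
  rw [← trace_pairing h, ← det_pairing h, Matrix.det_fin_three, Matrix.trace_fin_three]
  simp [pairing, mink_neg_left, mink_smul_left, mink_smul_right, *]
  linear_combination (-mink (nullNormal e f) (isomMat A *ᵥ nullNormal e f)) * hab

/-- In the null frame, skewness of `u` kills its entry on the normal and makes the entries on `e`
and `f` opposite; they are weighted by `a` and `b`. -/
lemma trace_lieAlg_mul (A : isomGroup) (he : mink e e = 0) (hf : mink f f = 0)
    (hef : mink e f = -1 / 2) {a b : ℝ} (hab : a * b = 1) (hAe : isomMat A *ᵥ e = a • e)
    (hAf : isomMat A *ᵥ f = b • f) {u : Mat3} (hu : u ∈ lieAlg) :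
    (u * isomMat A).trace = -2 * (a - b) * mink f (u *ᵥ e) := by
  have h := pairing_one he hf hef
  have ha : a ≠ 0 := left_ne_zero_of_mul_eq_one hab
  have hb : b ≠ 0 := right_ne_zero_of_mul_eq_one hab
  have h1 := mink_nullNormal_left e f
  have h2 := mink_nullNormal_right e f
  have h3 := mink_nullNormal_self e f
  rw [he, hf, hef] at h3
  set n := nullNormal e f with hn
  have h7 : mink e (isomMat A *ᵥ n) = 0 := by
    have := mink_isom A e n
    rw [hAe, mink_smul_left, h1] at this
    exact (mul_eq_zero.1 this).resolve_left ha
  have h8 : mink f (isomMat A *ᵥ n) = 0 := by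
    have := mink_isom A f n
    rw [hAf, mink_smul_left, h2] at this
    exact (mul_eq_zero.1 this).resolve_left hb
  have hQ := h
  rw [pairing_eq, mul_one] at hQ
  have hAn : isomMat A *ᵥ n = mink n (isomMat A *ᵥ n) • n := by
    have hv (x : Mink) (h1 : mink e x = 0) (h2 : mink f x = 0) (h3 : mink n x = 0) : x = 0 := by
      have hQx : (Matrix.of fun i j => (![(-2 : ℝ) • f, (-2 : ℝ) • e, n] : Fin 3 → Mink) i j *
          (![1, 1, -1] : Mink) j) *ᵥ x = 0 := by
        simp only [mink] at h1 h2 h3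
        ext i
        fin_cases i <;> simp [Matrix.mulVec, dotProduct, Fin.sum_univ_three] <;> linarith
      have := congrArg (fun v => (Matrix.of ![e, f, n])ᵀ *ᵥ v) hQx
      simpa only [Matrix.mulVec_mulVec, mul_eq_one_comm.1 hQ, Matrix.one_mulVec,
        Matrix.mulVec_zero] using this
    refine sub_eq_zero.1 (hv _ ?_ ?_ ?_)
    · rw [mink_sub_right, mink_smul_right, h7, h1]; ring
    · rw [mink_sub_right, mink_smul_right, h8, h2]; ring
    · rw [mink_sub_right, mink_smul_right, h3]; ring
  have hun : mink n (u *ᵥ n) = 0 := by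
    have := hu n n
    rw [mink_comm] at this
    linarith
  have hue : mink e (u *ᵥ f) = -mink f (u *ᵥ e) := by
    have := hu e f
    rw [mink_comm] at this
    linarith
  rw [← trace_pairing h, Matrix.trace_fin_three]
  simp only [pairing, Matrix.of_apply, ← Matrix.mulVec_mulVec, Matrix.cons_val, hAe, hAf,
    Matrix.mulVec_smul, mink_smul_left, mink_smul_right, hue]
  rw [hAn, Matrix.mulVec_smul, mink_smul_right, hun]
  ring

end NullFrame

/-! ### The derivative of the translation length -/

lemma lieAlg_trace {u : Mat3} (hu : u ∈ lieAlg) : u.trace = 0 := by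
  have h (i : Fin 3) := hu (Pi.single i 1) (Pi.single i 1)
  have h0 := h 0
  have h1 := h 1
  have h2 := h 2
  simp [mink] at h0 h1 h2
  rw [Matrix.trace_fin_three]
  linarith

/-- The linear term of `det (1 + t u)` is the trace of `u`, so only the trace contributes to the
derivative of `hypLength`. -/
lemma hasDerivAt_det_of_trace_eq_zero {u : Mat3} (hu : u.trace = 0) (A : Mat3) :
    HasDerivAt (fun t : ℝ => (A + t • (u * A)).det) 0 0 := by
  obtain ⟨p, q, h⟩ : ∃ p q : ℝ, ∀ t : ℝ,
      (A + t • (u * A)).det = (1 + t ^ 2 * p + t ^ 3 * q) * A.det := by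
    refine ⟨u 0 0 * u 1 1 + u 0 0 * u 2 2 + u 1 1 * u 2 2 - u 0 1 * u 1 0 - u 0 2 * u 2 0 -
      u 1 2 * u 2 1, u.det, fun t => ?_⟩
    have e : A + t • (u * A) = (1 + t • u) * A := by rw [add_mul, one_mul, smul_mul_assoc]
    rw [e, Matrix.det_mul]
    congr 1
    rw [Matrix.trace_fin_three] at hu
    simp [Matrix.det_fin_three]
    linear_combination t * hu
  simp only [h]
  have := ((((hasDerivAt_pow 2 (0 : ℝ)).mul_const p).const_add 1).add
    ((hasDerivAt_pow 3 (0 : ℝ)).mul_const q)).mul_const A.det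
  simpa using this

lemma lineDeriv_hypLength {u A : Mat3} (hu : u ∈ lieAlg) (hA : 1 < (A.trace - A.det) / 2) :
    lineDeriv ℝ hypLength A (u * A) =
      (u * A).trace / 2 / √(((A.trace - A.det) / 2) ^ 2 - 1) := by
  refine HasDerivAt.deriv ?_
  have h1 : HasDerivAt (fun t : ℝ => (A + t • (u * A)).trace) (u * A).trace 0 := by
    simp only [Matrix.trace_add, Matrix.trace_smul, smul_eq_mul]
    simpa using ((hasDerivAt_id (0 : ℝ)).mul_const (u * A).trace).const_add A.trace
  have h2 := (h1.sub (hasDerivAt_det_of_trace_eq_zero (lieAlg_trace hu) A)).div_const 2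
  have h3 : HasDerivAt Real.arcosh (√(((A.trace - A.det) / 2) ^ 2 - 1))⁻¹
      (((A + (0 : ℝ) • (u * A)).trace - (A + (0 : ℝ) • (u * A)).det) / 2) := by
    rw [zero_smul, add_zero]
    exact Real.hasDerivAt_arcosh hA
  have h4 := h3.comp 0 h2
  rw [sub_zero, mul_comm, ← div_eq_mul_inv] at h4
  exact h4

/-! ### Axes of non-trivial elements -/

namespace DecoratedMetric

variable {r Q : ℕ} {m : DecoratedMetric r Q}

namespace Core

variable (D : m.Core)

lemma mink_hol_conj (g γ : FreeGroup (Fin r)) (y : Mink) :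
    mink (m.hol γ *ᵥ y) (m.hol g *ᵥ m.hol γ *ᵥ y) = mink y (m.hol (γ⁻¹ * g * γ) *ᵥ y) := by
  rw [hol_mul_mulVec, hol_mul_mulVec, mink_comm y, mink_hol_inv_left, mink_comm]

/-- The displacement of an element attains its minimum on the core. -/
lemma exists_min_displacement (g : FreeGroup (Fin r)) : ∃ x ∈ D.carrier, ∀ x' ∈ D.carrier,
    -mink x (m.hol g *ᵥ x) ≤ -mink x' (m.hol g *ᵥ x') := by
  classical
  have hmin (h : FreeGroup (Fin r)) : ∃ y ∈ D.fund, ∀ y' ∈ D.fund,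
      -mink y (m.hol h *ᵥ y) ≤ -mink y' (m.hol h *ᵥ y') := by
    have hcont : Continuous fun y : Mink => -mink y (m.hol h *ᵥ y) := by
      simp only [mink]; fun_prop
    exact D.compact.exists_isMinOn ⟨_, D.origin_mem⟩ hcont.continuousOn
  choose Y hY hYmin using hmin
  -- Only conjugates that move some point of the fundamental set by at most `T` can beat `g` at the
  -- origin, and they are finitely many; each attains its minimum on the compact set.
  set T := -mink D.origin (m.hol g *ᵥ D.origin)
  obtain ⟨h, hh, hhmin⟩ := Finset.exists_min_image
    ((D.near T).filter fun h => ∃ γ, γ⁻¹ * g * γ = h) (fun h => -mink (Y h) (m.hol h *ᵥ Y h))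
    ⟨g, Finset.mem_filter.2 ⟨D.mem_near D.origin_mem D.origin_mem le_rfl, 1, by simp⟩⟩
  obtain ⟨-, γ, hγ⟩ := Finset.mem_filter.1 hh
  refine ⟨m.hol γ *ᵥ Y h, D.invariant _ _ (D.fund_subset (hY h)), fun x' hx' => ?_⟩
  obtain ⟨δ, y, hy, rfl⟩ := D.cover x' hx'
  rw [mink_hol_conj, mink_hol_conj, hγ]
  have hle (k : FreeGroup (Fin r)) (hk : k ∈ (D.near T).filter fun h => ∃ γ, γ⁻¹ * g * γ = h)
      (y : Mink) (hy : y ∈ D.fund) :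
      -mink (Y h) (m.hol h *ᵥ Y h) ≤ -mink y (m.hol k *ᵥ y) :=
    (hhmin k hk).trans (hYmin k y hy)
  rcases le_total (-mink y (m.hol (δ⁻¹ * g * δ) *ᵥ y)) T with hT | hT
  · exact hle _ (Finset.mem_filter.2 ⟨D.mem_near hy hy hT, δ, rfl⟩) _ hy
  · refine le_trans (hle g ?_ D.origin D.origin_mem) hT
    exact Finset.mem_filter.2 ⟨D.mem_near D.origin_mem D.origin_mem le_rfl, 1, by simp⟩

/-- Every non-trivial element has an axis in the core. -/
lemma exists_axis {g : FreeGroup (Fin r)} (hg : g ≠ 1) : ∃ x ∈ D.carrier,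
    1 < -mink x (m.hol g *ᵥ x) ∧
    m.hol g *ᵥ m.hol g *ᵥ x = (2 * -mink x (m.hol g *ᵥ x)) • m.hol g *ᵥ x - x := by
  obtain ⟨x, hx, hmin⟩ := D.exists_min_displacement g
  have hxh := D.subset hx
  have hgx := m.hol_hypPlane g hxh
  refine ⟨x, hx, lt_of_le_of_ne (one_le_neg_mink hxh hgx) fun h => ?_, ?_⟩
  -- A fixed point would bound the displacement of all powers.
  · have hfix := eq_of_neg_mink_eq_one hxh hgx h.symm
    have hpow (n : ℕ) : m.hol (g ^ n) *ᵥ x = x := by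
      induction n with
      | zero => rw [pow_zero, hol_one, Matrix.one_mulVec]
      | succ n ih => rw [pow_succ, hol_mul_mulVec, ← hfix, ih]
    obtain ⟨n, hn⟩ := m.exists_pow_two_two_gt hg (4 * (x 2 * x 2))
    have := isom_two_two_le (m.ρ (g ^ n)) hxh hxh
    change m.hol (g ^ n) 2 2 ≤ _ * -mink x (m.hol (g ^ n) *ᵥ x) at this
    rw [hpow, hxh.1] at this
    linarith
  · obtain ⟨a, ha, ha2, hm⟩ := exists_midpoint hxh hgx
    have hmid := hmin _ (D.convex x hx _ (D.invariant g x hx) a a ha.le ha.le hm)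
    set y := m.hol g *ᵥ x with hy
    have h1 : mink y (m.hol g *ᵥ y) = mink x y := m.mink_hol g x y
    have h2 := hxh.1
    have h3 := hgx.1
    have h4 := (m.hol_hypPlane g hgx).1
    have hc := one_le_neg_mink hxh hgx
    -- Minimality against the midpoint of `x` and `gx` says that `d(x, g²x) ≥ 2 d(x, gx)`, which
    -- puts the three points on one geodesic.
    have hd : 2 * mink x y ^ 2 - 1 ≤ -mink x (m.hol g *ᵥ y) := by
      simp only [Matrix.mulVec_add, Matrix.mulVec_smul, mink_add_left, mink_add_right,
        mink_smul_left, mink_smul_right, ← hy, h1, h3] at hmid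
      have h5 : 0 < a ^ 2 := by positivity
      have h6 : (2 + 2 * -mink x y) * -mink x y ≤
          -mink x (m.hol g *ᵥ y) - 2 * mink x y + 1 := by
        have : a ^ 2 * ((2 + 2 * -mink x y) * -mink x y) ≤
            a ^ 2 * (-mink x (m.hol g *ᵥ y) - 2 * mink x y + 1) := by
          calc _ = -mink x y := by rw [← mul_assoc, ha2, one_mul]
            _ ≤ _ := by linarith
        exact le_of_mul_le_mul_left this h5
      linarith
    -- The vector is orthogonal to `gx`, and `hd` makes its square nonpositive.
    have hw : m.hol g *ᵥ y - (2 * -mink x y) • y + x = 0 := by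
      refine eq_zero_of_orthogonal hgx ?_ ?_
      · rw [mink_add_left, mink_sub_left, mink_smul_left, mink_comm _ y, h1, h3]; ring
      · simp only [mink_add_left, mink_sub_left, mink_smul_left, mink_add_right, mink_sub_right,
          mink_smul_right, h1, h2, h3, h4, mink_comm (m.hol g *ᵥ y) y,
          mink_comm (m.hol g *ᵥ y) x, mink_comm y x]
        linarith
    rw [sub_add_eq_add_sub, sub_eq_zero] at hw
    exact eq_sub_of_add_eq hw

/-- The eigenvectors of the holonomy of a non-trivial element, normalised so that their sum is a
point of the core, and the resulting formulas for the length and its derivative. -/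
lemma exists_eigen {g : FreeGroup (Fin r)} (hg : g ≠ 1) : ∃ e ∈ futureLight, ∃ f ∈ futureLight,
    ∃ l : ℝ, 0 < l ∧ mink e f = -1 / 2 ∧ e + f ∈ D.carrier ∧
      m.hol g *ᵥ e = Real.exp l • e ∧ m.hol g *ᵥ f = Real.exp (-l) • f := by
  obtain ⟨x, hx, hc, hgg⟩ := D.exists_axis hg
  have hxh := D.subset hx
  have hgx := m.hol_hypPlane g hxh
  set c := -mink x (m.hol g *ᵥ x) with hcdef
  set y := m.hol g *ᵥ x with hy
  have hl := Real.arcosh_pos hc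
  set l := Real.arcosh c
  have hcosh : Real.cosh l = c := Real.cosh_arcosh hc.le
  have hs : 0 < Real.sinh l := Real.sinh_pos_iff.2 hl
  have hab : Real.exp l * Real.exp (-l) = 1 := by
    rw [← Real.exp_add, add_neg_cancel, Real.exp_zero]
  have hsum : Real.exp l + Real.exp (-l) = 2 * c := by rw [← hcosh, Real.cosh_eq]; ring
  have hdiff : Real.exp l - Real.exp (-l) = 2 * Real.sinh l := by rw [Real.sinh_eq]; ring
  have hxy : mink x y = -c := by rw [hcdef]; ring
  have hyx : mink y x = -c := by rw [mink_comm, hxy]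
  set p := Real.exp l with hp
  set q := Real.exp (-l) with hq
  set s := Real.sinh l
  have h2 := hxh.1
  have h3 := hgx.1
  have hs2 : (2 * s) ^ 2 = 4 * (c ^ 2 - 1) := by
    rw [← hdiff]; linear_combination (p + q + 2 * c) * hsum - 4 * hab
  have hinv : (2 * s)⁻¹ * (2 * s) = 1 := inv_mul_cancel₀ (by positivity)
  set k := (2 * s)⁻¹
  clear_value k s p q l c y
  have hk2 : k ^ 2 * (4 * (c ^ 2 - 1)) = 1 := by rw [← hs2, ← mul_pow, hinv, one_pow]
  -- On the span of `x` and `y = gx`, `g` satisfies `X² - 2cX + 1 = (X - p)(X - q)`, so `(X - q)x`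
  -- and `(p - X)x` are eigenvectors; `k` makes their sum equal to `x`.
  refine ⟨k • (y - q • x), futureLight_of_neg_mink_pos hxh ?_ ?_, k • (p • x - y),
    futureLight_of_neg_mink_pos hxh ?_ ?_, l, hl, ?_, ?_, ?_, ?_⟩
  · simp only [mink_smul_left, mink_smul_right, mink_sub_left, mink_sub_right, h2, h3, hxy, hyx]
    linear_combination k ^ 2 * (hab - q * hsum)
  · simp only [mink_smul_right, mink_sub_right, h2, hxy]
    have : -(k * (-c - q * -1)) = 1 / 2 := by
      linear_combination hinv / 2 - k / 2 * hsum + k / 2 * hdiff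
    rw [this]; norm_num
  · simp only [mink_smul_left, mink_smul_right, mink_sub_left, mink_sub_right, h2, h3, hxy, hyx]
    linear_combination k ^ 2 * (hab - p * hsum)
  · simp only [mink_smul_right, mink_sub_right, h2, hxy]
    have : -(k * (p * -1 - -c)) = 1 / 2 := by
      linear_combination hinv / 2 + k / 2 * hsum + k / 2 * hdiff
    rw [this]; norm_num
  · simp only [mink_smul_left, mink_smul_right, mink_sub_left, mink_sub_right, h2, h3, hxy, hyx]
    linear_combination (-1 / 2) * hk2 + k ^ 2 * (hab - c * hsum)
  · have : k • (y - q • x) + k • (p • x - y) = (k * (p - q)) • x := by module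
    rw [this, hdiff, hinv, one_smul]
    exact hx
  · simp only [Matrix.mulVec_smul, Matrix.mulVec_sub, hgg]
    rw [← hy, ← hsum, ← hp]
    ext i
    simp only [Pi.smul_apply, Pi.sub_apply, smul_eq_mul]
    linear_combination (k * x i) * hab
  · simp only [Matrix.mulVec_smul, Matrix.mulVec_sub, hgg]
    rw [← hy, ← hsum, ← hq]
    ext i
    simp only [Pi.smul_apply, Pi.sub_apply, smul_eq_mul]
    linear_combination (-k * x i) * hab

end Core
end DecoratedMetric
namespace DecoratedMetric

variable {r Q : ℕ} {m : DecoratedMetric r Q}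

/-! ### Closed geodesics -/

lemma half_trace_sub_det {g : FreeGroup (Fin r)} {e f : Mink} {l : ℝ} (he : mink e e = 0)
    (hf : mink f f = 0) (hef : mink e f = -1 / 2) (hge : m.hol g *ᵥ e = Real.exp l • e)
    (hgf : m.hol g *ᵥ f = Real.exp (-l) • f) :
    ((m.hol g).trace - (m.hol g).det) / 2 = Real.cosh l := by
  have hab : Real.exp l * Real.exp (-l) = 1 := by
    rw [← Real.exp_add, add_neg_cancel, Real.exp_zero]
  have h := trace_sub_det (m.ρ g) he hf hef hab hge hgf
  change (m.hol g).trace - (m.hol g).det = _ at h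
  rw [h, Real.cosh_eq]

lemma closedLength_eq {g : FreeGroup (Fin r)} {e f : Mink} {l : ℝ} (hl : 0 ≤ l)
    (he : mink e e = 0)
    (hf : mink f f = 0) (hef : mink e f = -1 / 2) (hge : m.hol g *ᵥ e = Real.exp l • e)
    (hgf : m.hol g *ᵥ f = Real.exp (-l) • f) : m.closedLength g = l := by
  rw [closedLength, hypLength, half_trace_sub_det he hf hef hge hgf, Real.arcosh_cosh hl]

/-- The `sinh l` from differentiating `arcosh` cancels the difference of eigenvalues. -/
lemma dClosedLength_eq {g : FreeGroup (Fin r)} {e f : Mink} {l : ℝ} (hl : 0 < l)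
    (he : mink e e = 0)
    (hf : mink f f = 0) (hef : mink e f = -1 / 2) (hge : m.hol g *ᵥ e = Real.exp l • e)
    (hgf : m.hol g *ᵥ f = Real.exp (-l) • f) (z : m.variations) :
    m.dClosedLength g z = -2 * mink f (z.1.1 g *ᵥ e) := by
  have hab : Real.exp l * Real.exp (-l) = 1 := by
    rw [← Real.exp_add, add_neg_cancel, Real.exp_zero]
  have hs : 0 < Real.sinh l := Real.sinh_pos_iff.2 hl
  have hu := z.2.1 g
  have h := half_trace_sub_det he hf hef hge hgf
  have ht := trace_lieAlg_mul (m.ρ g) he hf hef hab hge hgf hu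
  change (z.1.1 g * m.hol g).trace = _ at ht
  have hdiff : Real.exp l - Real.exp (-l) = 2 * Real.sinh l := by rw [Real.sinh_eq]; ring
  rw [dClosedLength, lineDeriv_hypLength hu (by rw [h]; exact Real.one_lt_cosh.2 hl.ne'), h, ht,
    ← Real.sinh_sq, Real.sqrt_sq hs.le, hdiff]
  field_simp

namespace Core

variable (D : m.Core)

lemma closedLength_pos (D : m.Core) {g : FreeGroup (Fin r)} (hg : g ≠ 1) :
    0 < m.closedLength g := by
  obtain ⟨e, he, f, hf, l, hl, hef, -, hge, hgf⟩ := D.exists_eigen hg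
  rwa [closedLength_eq hl.le he.1 hf.1 hef hge hgf]

/-- The vectors depend only on `g`, so linearity in the variation becomes visible. -/
lemma exists_dClosedLength_eq (D : m.Core) {g : FreeGroup (Fin r)} (hg : g ≠ 1) :
    ∃ e f : Mink, ∀ z : m.variations, m.dClosedLength g z = -2 * mink f (z.1.1 g *ᵥ e) := by
  obtain ⟨e, he, f, hf, l, hl, hef, -, hge, hgf⟩ := D.exists_eigen hg
  exact ⟨e, f, dClosedLength_eq hl he.1 hf.1 hef hge hgf⟩

lemma closedLength_conj (g γ : FreeGroup (Fin r)) :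
    m.closedLength (γ⁻¹ * g * γ) = m.closedLength g := by
  have h1 : (m.hol (γ⁻¹ * g * γ)).trace = (m.hol g).trace := by
    rw [hol_mul, Matrix.trace_mul_comm, hol_mul, ← mul_assoc, hol_mul_inv, one_mul]
  have h2 : (m.hol (γ⁻¹ * g * γ)).det = (m.hol g).det := by
    rw [hol_mul, Matrix.det_mul_comm, hol_mul, ← mul_assoc, hol_mul_inv, one_mul]
  rw [closedLength, closedLength, hypLength, hypLength, h1, h2]

lemma mink_add_eigen {e f : Mink} (he : mink e e = 0) (hf : mink f f = 0)
    (hef : mink e f = -1 / 2) (a b c d : ℝ) :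
    mink (a • e + b • f) (c • e + d • f) = -(a * d + b * c) / 2 := by
  simp only [mink_add_left, mink_add_right, mink_smul_left, mink_smul_right, he, hf, hef,
    mink_comm f e]
  ring

/-- Closed geodesics have length bounded below. -/
lemma exists_closedLength_ge (D : m.Core) : ∃ l₀ : ℝ, 0 < l₀ ∧ l₀ ≤ 1 ∧
    ∀ g : FreeGroup (Fin r), g ≠ 1 → l₀ ≤ m.closedLength g := by
  classical
  obtain ⟨l₀, h0, hmin⟩ : ∃ l₀ : ℝ, 0 < l₀ ∧ ∀ h ∈ D.near (Real.cosh 1), h ≠ 1 →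
      l₀ ≤ m.closedLength h := by
    rcases ((D.near (Real.cosh 1)).filter (· ≠ 1)).eq_empty_or_nonempty with h | h
    · refine ⟨1, one_pos, fun k hk hk1 => ?_⟩
      have : k ∈ (D.near (Real.cosh 1)).filter (· ≠ 1) := Finset.mem_filter.2 ⟨hk, hk1⟩
      simp [h] at this
    · obtain ⟨k, hk, hmin⟩ := Finset.exists_min_image _ m.closedLength h
      exact ⟨m.closedLength k, D.closedLength_pos (Finset.mem_filter.1 hk).2,
        fun h hh h1 => hmin h (Finset.mem_filter.2 ⟨hh, h1⟩)⟩
  refine ⟨min l₀ 1, lt_min h0 one_pos, min_le_right _ _, fun g hg => ?_⟩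
  obtain ⟨e, he, f, hf, l, hl, hef, hx, hge, hgf⟩ := D.exists_eigen hg
  have hlen := closedLength_eq hl.le he.1 hf.1 hef hge hgf
  rcases le_total 1 l with h | h
  · exact (min_le_right _ _).trans (hlen ▸ h)
  · refine (min_le_left _ _).trans ?_
    -- A geodesic of length at most 1 is represented by a conjugate in the finite set of near
    -- elements.
    obtain ⟨γ, y, hy, hxy⟩ := D.cover _ hx
    have hd : -mink y (m.hol (γ⁻¹ * g * γ) *ᵥ y) = Real.cosh l := by
      rw [← mink_hol_conj, ← hxy, Matrix.mulVec_add, hge, hgf]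
      have := mink_add_eigen he.1 hf.1 hef 1 1 (Real.exp l) (Real.exp (-l))
      rw [one_smul, one_smul] at this
      rw [this, Real.cosh_eq]
      ring
    rw [← closedLength_conj g γ]
    refine hmin _ (D.mem_near hy hy ?_) fun h1 => hg ?_
    · rw [hd, Real.cosh_le_cosh, abs_of_pos hl, abs_one]
      exact h
    · have := congrArg (fun k => γ * k * γ⁻¹) h1
      simpa [mul_assoc] using this

/-- The derivatives of the lengths of closed geodesics are bounded relatively to the lengths. -/
lemma exists_abs_dClosedLength_le : ∃ A : ℝ, 0 ≤ A ∧ ∀ z : m.variations,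
    ∀ g : FreeGroup (Fin r), g ≠ 1 →
      |m.dClosedLength g z| ≤ A * D.size z * m.closedLength g := by
  obtain ⟨l₀, h0, -, hl₀⟩ := D.exists_closedLength_ge
  refine ⟨2 * D.radius ^ 2 * (2 + l₀⁻¹), by positivity, fun z g hg => ?_⟩
  have hlow := hl₀ g hg
  obtain ⟨e, he, f, hf, l, hl, hef, hx, hge, hgf⟩ := D.exists_eigen hg
  have hab : Real.exp l * Real.exp (-l) = 1 := by
    rw [← Real.exp_add, add_neg_cancel, Real.exp_zero]
  rw [closedLength_eq hl.le he.1 hf.1 hef hge hgf] at hlow ⊢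
  rw [dClosedLength_eq hl he.1 hf.1 hef hge hgf]
  obtain ⟨γ, y, hy, hxy⟩ := D.cover _ hx
  have hx' : m.hol g *ᵥ (e + f) = m.hol (g * γ) *ᵥ y := by rw [hol_mul_mulVec, ← hxy]
  have hgx : m.hol g *ᵥ (e + f) = Real.exp l • e + Real.exp (-l) • f := by
    rw [Matrix.mulVec_add, hge, hgf]
  have hfe : mink f e = -1 / 2 := by rw [mink_comm, hef]
  have hbound := D.abs_mink_cocycle_le_arcosh z hf he (1 / 4) hx (D.invariant g _ hx) hy hy hxy hx'
    -- On the axis, `x = αe + βf` with `αβ = 1`, so the product is exactly `αβ / 4`.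
    (fun a b _ _ hp => by
      have e1 : a • (e + f) + b • m.hol g *ᵥ (e + f) =
          (a + b * Real.exp l) • e + (a + b * Real.exp (-l)) • f := by rw [hgx]; module
      rw [e1] at hp ⊢
      have h1 := hp.1
      rw [mink_add_eigen he.1 hf.1 hef] at h1
      simp only [mink_add_left, mink_smul_left, he.1, hf.1, hef, hfe]
      linarith)
  have hdist : Real.arcosh (-mink (e + f) (m.hol g *ᵥ (e + f))) = l := by
    have := mink_add_eigen he.1 hf.1 hef 1 1 (Real.exp l) (Real.exp (-l))
    rw [one_smul, one_smul] at this
    rw [hgx, this, ← Real.arcosh_cosh hl.le]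
    congr 1
    rw [Real.arcosh_cosh hl.le, Real.cosh_eq]
    ring
  -- The contribution of `u(γ)` cancels because the eigenvalues on `e` and `f` are inverse to each
  -- other.
  have hpair : mink f ((z.1.1 (g * γ) - z.1.1 γ) *ᵥ e) = mink f (z.1.1 g *ᵥ e) := by
    have hge' : m.hol g⁻¹ *ᵥ e = Real.exp (-l) • e := by
      have := congrArg (fun v => Real.exp (-l) • m.hol g⁻¹ *ᵥ v) hge
      simp only [hol_inv_mulVec, Matrix.mulVec_smul, smul_smul] at this
      rw [mul_comm (Real.exp (-l)) (Real.exp l), hab, one_smul] at this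
      exact this.symm
    have hgf' : m.hol g⁻¹ *ᵥ f = Real.exp l • f := by
      have := congrArg (fun v => Real.exp l • m.hol g⁻¹ *ᵥ v) hgf
      simp only [hol_inv_mulVec, Matrix.mulVec_smul, smul_smul] at this
      rw [hab, one_smul] at this
      exact this.symm
    rw [cocycle, Matrix.sub_mulVec, Matrix.add_mulVec, mink_sub_right, mink_add_right, mink_conj,
      hge', hgf', Matrix.mulVec_smul, mink_smul_left, mink_smul_right]
    linear_combination mink f (z.1.1 γ *ᵥ e) * hab
  rw [hdist, hpair] at hbound
  -- The lower bound on lengths absorbs the additive constant of the segment estimate.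
  have hinv : 1 ≤ l₀⁻¹ * l := by
    rw [inv_mul_eq_div, le_div_iff₀ h0, one_mul]; exact hlow
  have hsz := D.size_nonneg z
  rw [abs_mul, abs_neg, abs_two]
  calc 2 * |mink f (z.1.1 g *ᵥ e)|
      ≤ 2 * ((2 * l + 1) * (4 * D.radius ^ 2 * D.size z * (1 / 4))) := by linarith
    _ = 2 * D.radius ^ 2 * D.size z * (2 * l + 1) := by ring
    _ ≤ 2 * D.radius ^ 2 * D.size z * (2 * l + l₀⁻¹ * l) := by gcongr
    _ = _ := by ring

end Core
end DecoratedMetric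

/-! ### Horoball connections -/

lemma exists_pos_le_of_finite {α : Type*} {s : Set α} (hs : s.Finite) {φ : α → ℝ}
    (h : ∀ x ∈ s, 0 < φ x) : ∃ ε : ℝ, 0 < ε ∧ ∀ x ∈ s, ε ≤ φ x := by
  rcases s.eq_empty_or_nonempty with rfl | hne
  · exact ⟨1, one_pos, by simp⟩
  · obtain ⟨x, hx, hmin⟩ := Set.exists_min_image s φ hs hne
    exact ⟨φ x, h x hx, hmin⟩

/-- Squared Euclidean distance in the Klein model. -/
def kleinDist (x y : Mink) : ℝ := (x 0 / x 2 - y 0 / y 2) ^ 2 + (x 1 / x 2 - y 1 / y 2) ^ 2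

lemma kleinDist_le (x y w : Mink) : kleinDist x w ≤ 2 * kleinDist x y + 2 * kleinDist y w := by
  simp only [kleinDist]
  nlinarith [sq_nonneg (x 0 / x 2 - y 0 / y 2 - (y 0 / y 2 - w 0 / w 2)),
    sq_nonneg (x 1 / x 2 - y 1 / y 2 - (y 1 / y 2 - w 1 / w 2))]

/-- An equality for light-like vectors; for causal ones the correction terms have a favourable sign.
-/
lemma mul_kleinDist_le {f h : Mink} (hf : f ∈ futureCausal) (hh : h ∈ futureCausal)
    (hf2 : 0 < f 2) (hh2 : 0 < h 2) : f 2 * h 2 * kleinDist f h ≤ 2 * -mink f h := by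
  have h1 := hf.1
  have h2 := hh.1
  simp only [mink, kleinDist] at *
  have e1 : f 2 * h 2 * ((f 0 / f 2 - h 0 / h 2) ^ 2 + (f 1 / f 2 - h 1 / h 2) ^ 2) =
      2 * -(f 0 * h 0 + f 1 * h 1 - f 2 * h 2) +
        (h 2 / f 2) * (f 0 * f 0 + f 1 * f 1 - f 2 * f 2) +
        (f 2 / h 2) * (h 0 * h 0 + h 1 * h 1 - h 2 * h 2) := by
    field_simp
    ring
  rw [e1]
  have := mul_nonneg (div_pos hh2 hf2).le (neg_nonneg.2 h1)
  have := mul_nonneg (div_pos hf2 hh2).le (neg_nonneg.2 h2)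
  linarith

lemma mink_expand (x y a b : Mink) (t : ℝ) : mink (x + t • a) (y + t • b) =
    mink x y + t * (mink a y + mink x b) + t ^ 2 * mink a b := by
  simp only [mink_add_left, mink_add_right, mink_smul_left, mink_smul_right]; ring

lemma lineDeriv_horoLength {x y : Mink} (h : mink x y ≠ 0) (a b : Mink) :
    lineDeriv ℝ horoLength (x, y) (a, b) = (mink a y + mink x b) / mink x y := by
  refine HasDerivAt.deriv ?_
  have h1 : HasDerivAt (fun t : ℝ => -(mink (x + t • a) (y + t • b)) / 2)
      (-(mink a y + mink x b) / 2) 0 := by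
    simp only [mink_expand]
    have := (((((hasDerivAt_id (0 : ℝ)).mul_const (mink a y + mink x b)).const_add
      (mink x y)).add ((hasDerivAt_pow 2 (0 : ℝ)).mul_const (mink a b))).neg).div_const 2
    simpa using this
  have h2 := h1.log (by simpa using h)
  rw [zero_smul, zero_smul, add_zero, add_zero] at h2
  have e : (mink a y + mink x b) / mink x y = -(mink a y + mink x b) / 2 / (-mink x y / 2) := by
    field_simp
  rw [e]
  exact h2

namespace DecoratedMetric

variable {r Q : ℕ} (m : DecoratedMetric r Q)

lemma exists_kleinDist_ge (i : Fin Q) : ∃ δ : ℝ, 0 < δ ∧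
    ∀ g, δ ≤ kleinDist (m.v i) (m.hol g *ᵥ basePoint) := by
  obtain ⟨δ, hδ, h⟩ : ∃ δ : ℝ, 0 < δ ∧
      ∀ g, δ ≤ dist (klein (m.v i)) (klein (m.hol g *ᵥ basePoint)) := by
    have := m.v_not_limit i
    rw [Metric.mem_closure_range_iff] at this
    push Not at this
    exact this
  refine ⟨δ ^ 2, by positivity, fun g => ?_⟩
  have hg := h g
  rw [Prod.dist_eq, Real.dist_eq, Real.dist_eq] at hg
  rw [kleinDist, ← sq_abs (_ / _ - _), ← sq_abs (m.v i 1 / _ - _)]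
  rcases le_max_iff.1 hg with h' | h'
  · have := pow_le_pow_left₀ hδ.le h' 2
    simp only [klein] at this
    nlinarith [sq_nonneg |m.v i 1 / m.v i 2 -
      (m.hol g *ᵥ basePoint) 1 / (m.hol g *ᵥ basePoint) 2|]
  · have := pow_le_pow_left₀ hδ.le h' 2
    simp only [klein] at this
    nlinarith [sq_nonneg |m.v i 0 / m.v i 2 -
      (m.hol g *ᵥ basePoint) 0 / (m.hol g *ᵥ basePoint) 2|]

lemma hol_basePoint_two (g : FreeGroup (Fin r)) : (m.hol g *ᵥ basePoint) 2 = m.hol g 2 2 :=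
  isom_basePoint_two _

/-- Away from a finite set of group elements, spikes are far from translates of spikes. -/
lemma exists_far_spikes (i j : Fin Q) : ∃ c T : ℝ, 0 < c ∧ ∀ g, T ≤ m.hol g 2 2 →
    c * m.hol g 2 2 ≤ -mink (m.v i) (m.hol g *ᵥ m.v j) := by
  obtain ⟨δ₁, hδ₁, hi⟩ := m.exists_kleinDist_ge i
  obtain ⟨δ₂, hδ₂, hj⟩ := m.exists_kleinDist_ge j
  have hvi := m.v_light i
  have hvj := m.v_light j
  have hvi2 := hvi.2
  have hvj2 := hvj.2
  refine ⟨m.v i 2 * m.v j 2 * δ₂ * δ₁ / 16, 16 / (δ₁ * δ₂), by positivity, fun g hg => ?_⟩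
  have ht1 := m.one_le_hol_two_two g
  set t := m.hol g 2 2 with ht
  set w := m.hol g *ᵥ m.v j with hw
  have hwl : w ∈ futureLight := m.hol_futureLight g hvj
  -- The spike `v j` is far from the orbit point of `g⁻¹`, so its translate `w` has time coordinate
  -- of order `t`.
  have hw2 : t * m.v j 2 * δ₂ ≤ 2 * w 2 := by
    have h1 := mul_kleinDist_le (futureLight_subset_futureCausal hvj)
      (hypPlane_subset_futureCausal (m.hol_hypPlane g⁻¹ basePoint_mem)) hvj.2
      (m.hol_hypPlane g⁻¹ basePoint_mem).2
    rw [mink_comm, mink_hol_inv_left, mink_basePoint_left, hol_basePoint_two,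
      hol_inv_two_two] at h1
    refine le_trans ?_ h1
    rw [mul_comm t]
    exact mul_le_mul_of_nonneg_left (hj _) (by positivity)
  -- The product of `w` with the orbit point of `g` does not depend on `g`, while both time
  -- coordinates are large: the two are close in the Klein model.
  have hwa : w 2 * t * kleinDist w (m.hol g *ᵥ basePoint) ≤ 2 * m.v j 2 := by
    have h1 := mul_kleinDist_le (futureLight_subset_futureCausal hwl)
      (hypPlane_subset_futureCausal (m.hol_hypPlane g basePoint_mem)) hwl.2
      (m.hol_hypPlane g basePoint_mem).2
    rwa [hw, mink_hol, mink_basePoint_right, hol_basePoint_two] at h1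
  have hk0 : 0 ≤ kleinDist w (m.hol g *ᵥ basePoint) := by unfold kleinDist; positivity
  have hwa' : kleinDist w (m.hol g *ᵥ basePoint) ≤ δ₁ / 4 := by
    rw [div_le_iff₀ (by positivity)] at hg
    by_contra! hcon
    have h1 : t * m.v j 2 * δ₂ * t * (δ₁ / 4) < 4 * m.v j 2 := by
      calc t * m.v j 2 * δ₂ * t * (δ₁ / 4)
          < t * m.v j 2 * δ₂ * t * kleinDist w (m.hol g *ᵥ basePoint) := by gcongr
        _ ≤ 2 * w 2 * t * kleinDist w (m.hol g *ᵥ basePoint) := by gcongr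
        _ ≤ 4 * m.v j 2 := by linarith
    have h2 : 16 * (t * m.v j 2) ≤ t * (δ₁ * δ₂) * (t * m.v j 2) :=
      mul_le_mul_of_nonneg_right hg (by positivity)
    nlinarith [mul_le_mul_of_nonneg_right ht1 hvj2.le]
  -- The spike `v i` is far from the orbit, hence far from `w`.
  have hvw : δ₁ / 4 ≤ kleinDist (m.v i) w := by
    have := kleinDist_le (m.v i) w (m.hol g *ᵥ basePoint)
    linarith [hi g]
  have h1 := mul_kleinDist_le (futureLight_subset_futureCausal hvi)
    (futureLight_subset_futureCausal hwl) hvi.2 hwl.2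
  have h2 : m.v i 2 * w 2 * (δ₁ / 4) ≤ m.v i 2 * w 2 * kleinDist (m.v i) w :=
    mul_le_mul_of_nonneg_left hvw (mul_pos hvi.2 hwl.2).le
  have h3 := mul_le_mul_of_nonneg_left hw2 (by positivity : 0 ≤ m.v i 2 * δ₁)
  linarith

/-- A vanishing product would make the two spikes parallel, so `i = j` and `g ≠ 1` fixes the ideal
point. All powers of `g` then give product zero, contradicting `exists_far_spikes`. -/
lemma mink_connection_neg {i j : Fin Q} {g : FreeGroup (Fin r)} (h : ¬(i = j ∧ g = 1)) :
    0 < -mink (m.v i) (m.hol g *ᵥ m.v j) := by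
  have hw := m.hol_futureLight g (m.v_light j)
  refine lt_of_le_of_ne (neg_mink_nonneg (futureLight_subset_futureCausal (m.v_light i))
    (futureLight_subset_futureCausal hw)) fun h0 => ?_
  have hpar := exists_smul_of_mink_eq_zero (m.v_light i) hw (by linarith)
  obtain rfl := m.v_inequiv i j g _ hpar
  have hg : g ≠ 1 := fun hg => h ⟨rfl, hg⟩
  have hpow (n : ℕ) : mink (m.v i) (m.hol (g ^ n) *ᵥ m.v i) = 0 := by
    obtain ⟨c, hc⟩ : ∃ c : ℝ, m.hol g *ᵥ m.v i = c • m.v i := by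
      set k := m.v i 2 / (m.hol g *ᵥ m.v i) 2 with hk
      have hk0 : k ≠ 0 := (div_pos (m.v_light i).2 hw.2).ne'
      refine ⟨k⁻¹, ?_⟩
      conv_rhs => rw [hpar]
      rw [smul_smul, inv_mul_cancel₀ hk0, one_smul]
    induction n with
    | zero => rw [pow_zero, hol_one, Matrix.one_mulVec]; exact (m.v_light i).1
    | succ n ih => rw [pow_succ, hol_mul_mulVec, hc, Matrix.mulVec_smul, mink_smul_right, ih,
        mul_zero]
  obtain ⟨c, T, hc, hfar⟩ := m.exists_far_spikes i i
  obtain ⟨n, hn⟩ := m.exists_pow_two_two_gt hg T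
  have := hfar _ hn.le
  rw [hpow] at this
  nlinarith [m.one_le_hol_two_two (g ^ n)]

/-- The product of the end points of a connection grows at least like the displacement. -/
lemma exists_connection_ge : ∃ c₀ : ℝ, 0 < c₀ ∧ ∀ i j g, ¬(i = j ∧ g = 1) →
    c₀ * m.hol g 2 2 ≤ -mink (m.v i) (m.hol g *ᵥ m.v j) := by
  have hpair (i j : Fin Q) : ∃ c₀ : ℝ, 0 < c₀ ∧ ∀ g, ¬(i = j ∧ g = 1) →
      c₀ * m.hol g 2 2 ≤ -mink (m.v i) (m.hol g *ᵥ m.v j) := by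
    obtain ⟨c, T, hc, hfar⟩ := m.exists_far_spikes i j
    obtain ⟨ε, hε, hmin⟩ := exists_pos_le_of_finite
      (s := {g | m.hol g 2 2 ≤ T ∧ ¬(i = j ∧ g = 1)})
      (φ := fun g => -mink (m.v i) (m.hol g *ᵥ m.v j) / m.hol g 2 2)
      ((m.finite_hol_two_two_le T).subset fun g hg => hg.1) fun g hg =>
        div_pos (m.mink_connection_neg hg.2) (zero_lt_one.trans_le (m.one_le_hol_two_two g))
    refine ⟨min c ε, lt_min hc hε, fun g hg => ?_⟩
    have ht := zero_lt_one.trans_le (m.one_le_hol_two_two g)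
    rcases le_total T (m.hol g 2 2) with h | h
    · exact (mul_le_mul_of_nonneg_right (min_le_left _ _) ht.le).trans (hfar g h)
    · have := hmin g ⟨h, hg⟩
      rw [le_div_iff₀ ht] at this
      exact (mul_le_mul_of_nonneg_right (min_le_right _ _) ht.le).trans this
  choose c hc hle using hpair
  obtain ⟨ε, hε, hmin⟩ := exists_pos_le_of_finite (Set.finite_univ (α := Fin Q × Fin Q))
    (φ := fun p => c p.1 p.2) fun p _ => hc p.1 p.2
  exact ⟨ε, hε, fun i j g hg => (mul_le_mul_of_nonneg_right (hmin (i, j) trivial)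
    (zero_le_one.trans (m.one_le_hol_two_two g))).trans (hle i j g hg)⟩

lemma dConnLength_eq (c : m.Connection) (z : m.variations) : m.dConnLength c z =
    (mink (z.1.2 c.1.1) (m.hol c.1.2.2 *ᵥ m.v c.1.2.1) +
      mink (m.v c.1.1) ((z.1.1 c.1.2.2 * m.hol c.1.2.2) *ᵥ m.v c.1.2.1 +
        m.hol c.1.2.2 *ᵥ z.1.2 c.1.2.1)) / mink (m.v c.1.1) (m.hol c.1.2.2 *ᵥ m.v c.1.2.1) := by
  have := m.mink_connection_neg c.2
  exact lineDeriv_horoLength (by linarith) _ _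

end DecoratedMetric
-- Bounds for the derivatives of connection lengths
namespace DecoratedMetric

variable {r Q : ℕ} {m : DecoratedMetric r Q}

namespace Core

variable (D : m.Core)

/-- The size of a variation, spikes included. -/
def fullSize (z : m.variations) : ℝ := D.size z + ∑ i, ‖z.1.2 i‖

lemma size_le_fullSize (z : m.variations) : D.size z ≤ D.fullSize z :=
  le_add_of_nonneg_right (Finset.sum_nonneg fun _ _ => norm_nonneg _)

lemma norm_le_fullSize (z : m.variations) (i : Fin Q) : ‖z.1.2 i‖ ≤ D.fullSize z :=
  (Finset.single_le_sum (f := fun i => ‖z.1.2 i‖) (fun _ _ => norm_nonneg _)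
    (Finset.mem_univ i)).trans (le_add_of_nonneg_left (D.size_nonneg z))

lemma fullSize_nonneg (z : m.variations) : 0 ≤ D.fullSize z :=
  (D.size_nonneg z).trans (D.size_le_fullSize z)

/-- Only finitely many evaluations enter, so the product topology suffices. -/
lemma continuous_fullSize : Continuous D.fullSize := by
  unfold fullSize size entrySum
  refine .add (continuous_finsetSum _ fun s _ => continuous_finsetSum _ fun i _ =>
    continuous_finsetSum _ fun j _ => ?_) (continuous_finsetSum _ fun i _ => ?_)
  · have h : Continuous fun z : m.variations => z.1.1 s :=
      (continuous_apply s).comp (continuous_fst.comp continuous_subtype_val)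
    exact (h.matrix_elem i j).abs
  · exact ((continuous_apply i).comp (continuous_snd.comp continuous_subtype_val)).norm

lemma fullSize_zero : D.fullSize 0 = 0 := by simp [fullSize, size, entrySum]

lemma hol_mulVec_two_le (g : FreeGroup (Fin r)) {f : Mink} (hf : f ∈ futureCausal) :
    (m.hol g *ᵥ f) 2 ≤ 2 * (m.hol g 2 2 * f 2) := by
  have h := neg_mink_le (hypPlane_subset_futureCausal (m.hol_hypPlane g⁻¹ basePoint_mem)) hf
  rwa [mink_hol_inv_left, mink_basePoint_left, hol_basePoint_two, hol_inv_two_two] at h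

lemma cocycle_one (z : m.variations) : z.1.1 1 = 0 := by
  have := cocycle z 1 1
  rw [hol_one, inv_one, hol_one, mul_one, one_mul, mul_one] at this
  simpa using this

/-- The middle term in the derivative of the length of a connection. -/
lemma exists_abs_mink_cocycle_spikes_le : ∃ A E : ℝ, 0 ≤ A ∧ 0 < E ∧ ∀ (z : m.variations) i j g,
    |mink (m.v i) (z.1.1 g *ᵥ m.hol g *ᵥ m.v j)| ≤
      (2 * Real.log (E * m.hol g 2 2) + 1) * (A * D.size z * m.hol g 2 2) ∧
    1 ≤ E * m.hol g 2 2 := by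
  set W : ℝ := ∑ i, m.v i 2
  have hW (i : Fin Q) : m.v i 2 ≤ W :=
    Finset.single_le_sum (f := fun i => m.v i 2) (fun i _ => (m.v_light i).2.le)
      (Finset.mem_univ i)
  have hW0 : 0 ≤ W := Finset.sum_nonneg fun i _ => (m.v_light i).2.le
  have hR := D.one_le_radius
  have hR0 := D.radius_pos
  have hoF := D.origin_mem
  have hoC := D.fund_subset hoF
  have hoh := D.subset hoC
  have hoc := hypPlane_subset_futureCausal hoh
  have hoR := D.le_radius _ hoF
  set R := D.radius
  set o := D.origin
  set M : ℝ := 16 * R ^ 3 * W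
  refine ⟨4 * R ^ 2 * (M ^ 2 * (4 * R ^ 2)), 8 * R ^ 2, by positivity, by positivity,
    fun z i j g => ?_⟩
  have ht1 := m.one_le_hol_two_two g
  have hgoC := D.invariant g o hoC
  have hgoh := D.subset hgoC
  have hc1 := one_le_neg_mink hoh hgoh
  set c := -mink o (m.hol g *ᵥ o) with hc
  set t := m.hol g 2 2
  have htc : t ≤ 4 * R ^ 2 * c := D.hol_two_two_le hoF hoF g
  have hct : c ≤ 4 * R ^ 2 * t := by
    have h1 := neg_mink_le hoc (hypPlane_subset_futureCausal hgoh)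
    have h2 := hol_mulVec_two_le (m := m) g hoc
    have h3 : o 2 * (m.hol g *ᵥ o) 2 ≤ R * (2 * (t * R)) :=
      mul_le_mul hoR (h2.trans (by gcongr)) hgoh.2.le hR0.le
    calc c ≤ _ := h1
      _ ≤ 2 * (R * (2 * (t * R))) := by linarith
      _ = _ := by ring
  have hvi := m.v_light i
  have hf := m.hol_futureLight g (m.v_light j)
  have hMR : 2 * R * W ≤ M := by
    have : R ≤ R ^ 3 := by nlinarith [mul_le_mul hR hR (by norm_num) hR0.le]
    have := mul_le_mul_of_nonneg_right this hW0
    have := mul_nonneg hR0.le hW0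
    simp only [M]; linarith
  have hnear (k : Fin Q) : -mink o (m.v k) ≤ M := by
    have h1 := neg_mink_le hoc (futureLight_subset_futureCausal (m.v_light k))
    have h2 := mul_le_mul hoR (hW k) (m.v_light k).2.le hR0.le
    linarith
  have hfar (k : Fin Q) (h : FreeGroup (Fin r)) (hh : m.hol h 2 2 = t) :
      -mink o (m.hol h *ᵥ m.v k) ≤ M * c := by
    have h1 := neg_mink_le hoc (futureLight_subset_futureCausal (m.hol_futureLight h (m.v_light k)))
    have h2 := hol_mulVec_two_le (m := m) h (futureLight_subset_futureCausal (m.v_light k))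
    rw [hh] at h2
    have h3 : t * m.v k 2 ≤ 4 * R ^ 2 * c * W :=
      mul_le_mul htc (hW k) (m.v_light k).2.le (by positivity)
    have h4 := mul_le_mul hoR (h2.trans (mul_le_mul_of_nonneg_left h3 zero_le_two))
      (m.hol_futureLight h (m.v_light k)).2.le hR0.le
    calc _ ≤ _ := h1
      _ ≤ 2 * (R * (2 * (4 * R ^ 2 * c * W))) := by linarith
      _ = M * c := by simp only [M]; ring
  have hbound := D.abs_mink_cocycle_le_arcosh z hvi hf (M ^ 2 * (4 * R ^ 2 * t))
    (γ := 1) (γ' := g) hoC hgoC hoF hoF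
    (by rw [hol_one, Matrix.one_mulVec]) rfl (fun a b ha hb hp => by
      have e1 : -mink (a • o + b • m.hol g *ᵥ o) (m.v i) ≤ M * (a + b * c) := by
        have h1 := hfar i g⁻¹ (m.hol_inv_two_two g)
        rw [mink_comm, mink_hol_inv_left, mink_comm] at h1
        rw [mink_add_left, mink_smul_left, mink_smul_left]
        nlinarith [mul_le_mul_of_nonneg_left (hnear i) ha, mul_le_mul_of_nonneg_left h1 hb]
      have e2 : -mink (a • o + b • m.hol g *ᵥ o) (m.hol g *ᵥ m.v j) ≤ M * (a * c + b) := by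
        have h1 := hfar j g rfl
        rw [mink_add_left, mink_smul_left, mink_smul_left, mink_hol]
        nlinarith [mul_le_mul_of_nonneg_left (hnear j) hb, mul_le_mul_of_nonneg_left h1 ha]
      have e3 := neg_mink_nonneg (hypPlane_subset_futureCausal hp)
        (futureLight_subset_futureCausal hvi)
      have e4 := neg_mink_nonneg (hypPlane_subset_futureCausal hp)
        (futureLight_subset_futureCausal hf)
      have e5 := mul_le_mul e1 e2 e4 (e3.trans e1)
      have e6 : a ^ 2 + b ^ 2 + 2 * (a * b) * c = 1 := by
        have := hp.1
        simp only [mink_add_left, mink_add_right, mink_smul_left, mink_smul_right, hoh.1, hgoh.1,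
          mink_comm (m.hol g *ᵥ o) o] at this
        rw [hc]; linear_combination -this
      -- By `e6`, the difference of the two sides is `ab(c² - 1)`.
      have e7 : (a + b * c) * (a * c + b) ≤ c := by
        have : 0 ≤ a * b * (c ^ 2 - 1) := mul_nonneg (mul_nonneg ha hb) (by nlinarith)
        linear_combination this + c * e6
      calc _ = -mink (a • o + b • m.hol g *ᵥ o) (m.v i) *
            -mink (a • o + b • m.hol g *ᵥ o) (m.hol g *ᵥ m.v j) := by ring
        _ ≤ M ^ 2 * ((a + b * c) * (a * c + b)) := by linarith
        _ ≤ M ^ 2 * (4 * R ^ 2 * t) := mul_le_mul_of_nonneg_left (e7.trans hct) (sq_nonneg M))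
  rw [cocycle_one, sub_zero] at hbound
  -- `arcosh c ≤ log (2c)` and `c ≤ 4R²t` give the constant `8R²`.
  have hlog : Real.arcosh c ≤ Real.log (8 * R ^ 2 * t) := by
    rw [Real.arcosh]
    refine Real.log_le_log (by positivity) ?_
    have : √(c ^ 2 - 1) ≤ c := Real.sqrt_le_iff.2 ⟨by linarith, by linarith⟩
    linarith
  refine ⟨hbound.trans ?_, ?_⟩
  · have := D.size_nonneg z
    calc _ ≤ (2 * Real.log (8 * R ^ 2 * t) + 1) *
          (4 * R ^ 2 * D.size z * (M ^ 2 * (4 * R ^ 2 * t))) := by gcongr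
      _ = _ := by ring
  · nlinarith [mul_le_mul hR hR (by norm_num) hR0.le]

/-- The derivatives of the lengths of connections are bounded relatively to the lengths, up to an
additive constant. -/
lemma exists_abs_dConnLength_le : ∃ A E : ℝ, 0 ≤ A ∧ 0 ≤ E ∧
    ∀ (z : m.variations) (c : m.Connection),
      |m.dConnLength c z| ≤ A * D.fullSize z * (m.connLength c + E) := by
  obtain ⟨A, E, hA, hE, hmid⟩ := D.exists_abs_mink_cocycle_spikes_le
  obtain ⟨c₀, hc₀, hlow⟩ := m.exists_connection_ge
  set W : ℝ := ∑ i, m.v i 2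
  have hW (i : Fin Q) : m.v i 2 ≤ W :=
    Finset.single_le_sum (f := fun i => m.v i 2) (fun i _ => (m.v_light i).2.le)
      (Finset.mem_univ i)
  have hW0 : 0 ≤ W := Finset.sum_nonneg fun i _ => (m.v_light i).2.le
  refine ⟨(12 * W + 2 * A) / c₀, |Real.log (2 * E / c₀)| + 1, by positivity, by positivity,
    fun z c => ?_⟩
  rw [dConnLength_eq]
  have hneg := m.mink_connection_neg c.2
  have hden := hlow _ _ _ c.2
  have hlen : m.connLength c =
    Real.log (-mink (m.v c.1.1) (m.hol c.1.2.2 *ᵥ m.v c.1.2.1) / 2) := rfl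
  obtain ⟨⟨i, j, g⟩, hc⟩ := c
  simp only at *
  obtain ⟨hm1, hE1⟩ := hmid z i j g
  have ht1 := m.one_le_hol_two_two g
  have hinv := m.hol_inv_two_two g
  have hp := D.fullSize_nonneg z
  have hsz := D.size_le_fullSize z
  have hszi := D.norm_le_fullSize z i
  have hszj := D.norm_le_fullSize z j
  set p := D.fullSize z
  set t := m.hol g 2 2 with ht
  set d := -mink (m.v i) (m.hol g *ᵥ m.v j) with hd
  -- Since `d ≥ c₀ t`, the logarithm of the displacement is bounded by the connection length up to a
  -- constant.
  have hlogE : Real.log (E * t) ≤ m.connLength ⟨(i, j, g), hc⟩ + |Real.log (2 * E / c₀)| := by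
    have h1 : Real.log (E * t) ≤ Real.log (d / 2 * (2 * E / c₀)) := by
      refine Real.log_le_log (by positivity) ?_
      have : E * t = c₀ * t / 2 * (2 * E / c₀) := by field_simp
      rw [this]
      gcongr
    rw [Real.log_mul (x := d / 2) (by positivity) (by positivity), ← hlen] at h1
    linarith [le_abs_self (Real.log (2 * E / c₀))]
  have hL0 : 0 ≤ Real.log (E * t) := Real.log_nonneg hE1
  -- The extra 1 ensures `L ≥ 1`, so the two spike terms, which carry no logarithm, are also bounded
  -- by multiples of `L`.
  set L := m.connLength ⟨(i, j, g), hc⟩ + (|Real.log (2 * E / c₀)| + 1) with hL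
  have hspike (h : FreeGroup (Fin r)) (hh : m.hol h 2 2 = t) (a : Mink) (ha : ‖a‖ ≤ p)
      (k : Fin Q) : |mink a (m.hol h *ᵥ m.v k)| ≤ 6 * W * p * t := by
    have hk := m.v_light k
    have h2 := hol_mulVec_two_le (m := m) h (futureLight_subset_futureCausal hk)
    rw [hh] at h2
    have h4 : (m.hol h *ᵥ m.v k) 2 ≤ 2 * (t * W) :=
      h2.trans (by gcongr; exact hW k)
    refine (abs_mink_le a (futureLight_subset_futureCausal (m.hol_futureLight h hk))).trans ?_
    calc 3 * ‖a‖ * (m.hol h *ᵥ m.v k) 2 ≤ 3 * p * (2 * (t * W)) := by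
          refine mul_le_mul (by linarith) h4 (m.hol_futureLight h hk).2.le (by positivity)
      _ = _ := by ring
  have hs1 := hspike g rfl _ hszi j
  have hs2 := hspike g⁻¹ hinv _ hszj i
  rw [mink_comm, mink_hol_inv_left] at hs2
  rw [abs_div, ← abs_neg (mink (m.v i) (m.hol g *ᵥ m.v j)), ← hd, abs_of_pos hneg,
    div_le_iff₀ hneg, ← Matrix.mulVec_mulVec, mink_add_right]
  have hmid' : (2 * Real.log (E * t) + 1) * (A * D.size z * t) ≤ 2 * L * (A * p * t) := by
    have : 0 ≤ A * D.size z * t := mul_nonneg (mul_nonneg hA (D.size_nonneg z)) (by linarith)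
    refine mul_le_mul (by linarith) (by gcongr) this (by linarith)
  have hL1 : 1 ≤ L := by linarith
  have hWL : 12 * W * p * t ≤ 12 * W * p * t * L :=
    le_mul_of_one_le_right (by positivity) hL1
  have hfin : 12 * W * p * t * L + 2 * L * (A * p * t) ≤
      (12 * W + 2 * A) / c₀ * p * L * d := by
    calc _ = (12 * W + 2 * A) / c₀ * p * L * (c₀ * t) := by field_simp
      _ ≤ _ := by gcongr
  have h1 := abs_add_le (mink (z.1.2 i) (m.hol g *ᵥ m.v j))
    (mink (m.v i) (z.1.1 g *ᵥ m.hol g *ᵥ m.v j) + mink (m.v i) (m.hol g *ᵥ z.1.2 j))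
  have h2 := abs_add_le (mink (m.v i) (z.1.1 g *ᵥ m.hol g *ᵥ m.v j))
    (mink (m.v i) (m.hol g *ᵥ z.1.2 j))
  linarith

end Core

variable (m)

/-- A bounded length bounds the size of `g` by `exists_connection_ge`. -/
lemma finite_connLength_le (l : ℝ) : {c : m.Connection | m.connLength c ≤ l}.Finite := by
  obtain ⟨c₀, hc₀, hlow⟩ := m.exists_connection_ge
  have hfin := (Set.finite_univ (α := Fin Q)).prod ((Set.finite_univ (α := Fin Q)).prod
    (m.finite_hol_two_two_le (2 * Real.exp l / c₀)))
  refine Set.Finite.of_injOn (f := Subtype.val) (fun c hc => ?_) Subtype.val_injective.injOn hfin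
  refine ⟨trivial, trivial, ?_⟩
  have hpos := m.mink_connection_neg c.2
  have h1 := hlow _ _ _ c.2
  have h2 : Real.log (-mink (m.v c.1.1) (m.hol c.1.2.2 *ᵥ m.v c.1.2.1) / 2) ≤ l := hc
  rw [Real.log_le_iff_le_exp (by positivity)] at h2
  change m.hol c.1.2.2 2 2 ≤ _
  rw [le_div_iff₀ hc₀]
  linarith

lemma exists_connLength_ge : ∃ l₀ : ℝ, 0 < l₀ ∧ ∀ c : m.Connection, 0 < m.connLength c →
    l₀ ≤ m.connLength c := by
  obtain ⟨ε, hε, hmin⟩ := exists_pos_le_of_finite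
    (s := {c : m.Connection | m.connLength c ≤ 1 ∧ 0 < m.connLength c}) (φ := m.connLength)
    ((m.finite_connLength_le 1).subset fun c hc => hc.1) fun c hc => hc.2
  refine ⟨min ε 1, lt_min hε one_pos, fun c hc => ?_⟩
  rcases le_total (m.connLength c) 1 with h | h
  · exact (min_le_left _ _).trans (hmin c ⟨h, hc⟩)
  · exact (min_le_right _ _).trans h

/-! ### Uniformly lengthening variations -/

lemma dConnLength_add (c : m.Connection) (z z' : m.variations) :
    m.dConnLength c (z + z') = m.dConnLength c z + m.dConnLength c z' := by
  simp only [dConnLength_eq, Submodule.coe_add, Prod.fst_add, Prod.snd_add, Pi.add_apply, add_mul,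
    Matrix.add_mulVec, Matrix.mulVec_add, mink_add_left, mink_add_right]
  ring

lemma dConnLength_smul (c : m.Connection) (t : ℝ) (z : m.variations) :
    m.dConnLength c (t • z) = t * m.dConnLength c z := by
  simp only [dConnLength_eq, Submodule.coe_smul, Prod.smul_fst, Prod.smul_snd, Pi.smul_apply,
    Matrix.smul_mul, Matrix.smul_mulVec, Matrix.mulVec_smul, mink_add_right, mink_smul_left,
    mink_smul_right]
  ring

lemma dClosedLength_add {g : FreeGroup (Fin r)} (hg : g ≠ 1) (z z' : m.variations) :
    m.dClosedLength g (z + z') = m.dClosedLength g z + m.dClosedLength g z' := by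
  obtain ⟨D⟩ := m.nonempty_core
  obtain ⟨e, f, h⟩ := D.exists_dClosedLength_eq hg
  simp only [h, Submodule.coe_add, Prod.fst_add, Pi.add_apply, Matrix.add_mulVec, mink_add_right]
  ring

lemma dClosedLength_smul {g : FreeGroup (Fin r)} (hg : g ≠ 1) (t : ℝ) (z : m.variations) :
    m.dClosedLength g (t • z) = t * m.dClosedLength g z := by
  obtain ⟨D⟩ := m.nonempty_core
  obtain ⟨e, f, h⟩ := D.exists_dClosedLength_eq hg
  simp only [h, Submodule.coe_smul, Prod.smul_fst, Pi.smul_apply, Matrix.smul_mulVec,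
    mink_smul_right]
  ring

variable {m}

lemma UniformlyLengthens.add {z z' : m.variations} (hz : m.UniformlyLengthens z)
    (hz' : m.UniformlyLengthens z') : m.UniformlyLengthens (z + z') := by
  obtain ⟨ε, hε, h1, h2, h3⟩ := hz
  obtain ⟨ε', hε', h1', h2', h3'⟩ := hz'
  refine ⟨ε + ε', by positivity, fun g hg => ?_, fun c hc => ?_, fun c hc => ?_⟩
  · rw [dClosedLength_add m hg, add_mul]; exact add_le_add (h1 g hg) (h1' g hg)
  · rw [dConnLength_add, add_mul]; exact add_le_add (h2 c hc) (h2' c hc)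
  · rw [dConnLength_add]; exact add_le_add (h3 c hc) (h3' c hc)

lemma UniformlyLengthens.smul {z : m.variations} (hz : m.UniformlyLengthens z) {t : ℝ}
    (ht : 0 < t) : m.UniformlyLengthens (t • z) := by
  obtain ⟨ε, hε, h1, h2, h3⟩ := hz
  refine ⟨t * ε, by positivity, fun g hg => ?_, fun c hc => ?_, fun c hc => ?_⟩
  · rw [dClosedLength_smul m hg, mul_assoc]; exact mul_le_mul_of_nonneg_left (h1 g hg) ht.le
  · rw [dConnLength_smul, mul_assoc]; exact mul_le_mul_of_nonneg_left (h2 c hc) ht.le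
  · rw [dConnLength_smul]; exact mul_le_mul_of_nonneg_left (h3 c hc) ht.le

lemma UniformlyLengthens.combo {z z' : m.variations} (hz : m.UniformlyLengthens z)
    (hz' : m.UniformlyLengthens z') {a b : ℝ} (ha : 0 ≤ a) (hb : 0 ≤ b) (hab : a + b = 1) :
    m.UniformlyLengthens (a • z + b • z') := by
  rcases ha.eq_or_lt with rfl | ha
  · obtain rfl : b = 1 := by linarith
    simpa using hz'
  rcases hb.eq_or_lt with rfl | hb
  · obtain rfl : a = 1 := by linarith
    simpa using hz
  exact (hz.smul ha).add (hz'.smul hb)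

variable (m)

lemma isOpen_uniformlyLengthens : IsOpen {z : m.variations | m.UniformlyLengthens z} := by
  obtain ⟨D⟩ := m.nonempty_core
  obtain ⟨A, hA, hclosed⟩ := D.exists_abs_dClosedLength_le
  obtain ⟨B, E, hB, hE, hconn⟩ := D.exists_abs_dConnLength_le
  obtain ⟨l₀, hl₀, hlow⟩ := m.exists_connLength_ge
  rw [isOpen_iff_mem_nhds]
  rintro z ⟨ε, hε, h1, h2, h3⟩
  -- The sum dominates the constants of the three cases; the final 1 keeps it positive.
  set K := A + B * (1 + E / l₀) + B * E + 1 with hK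
  have hK0 : 0 < K := by positivity
  have hnear : {z' : m.variations | D.fullSize (z' - z) < ε / 2 / K} ∈ nhds z := by
    have hc : Continuous fun z' => D.fullSize (z' - z) :=
      D.continuous_fullSize.comp (continuous_id.sub continuous_const)
    exact (isOpen_lt hc continuous_const).mem_nhds (by
      change D.fullSize (z - z) < _
      rw [sub_self, D.fullSize_zero]; positivity)
  filter_upwards [hnear] with z' hz'
  obtain ⟨y, rfl⟩ : ∃ y, z' = z + y := ⟨z' - z, by abel⟩
  change D.fullSize (z + y - z) < _ at hz'
  rw [add_sub_cancel_left, lt_div_iff₀ hK0] at hz'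
  have hp := D.fullSize_nonneg y
  set p := D.fullSize y
  have hpA : A * p ≤ ε / 2 := by
    have : A ≤ K := by
      have : 0 ≤ B * (1 + E / l₀) + B * E + 1 := by positivity
      linarith
    nlinarith [mul_le_mul_of_nonneg_left this hp]
  have hpB : B * (1 + E / l₀) * p ≤ ε / 2 := by
    have : B * (1 + E / l₀) ≤ K := by
      have : 0 ≤ A + B * E + 1 := by positivity
      linarith
    nlinarith [mul_le_mul_of_nonneg_left this hp]
  have hpE : B * E * p ≤ ε / 2 := by
    have : B * E ≤ K := by
      have : 0 ≤ A + B * (1 + E / l₀) + 1 := by positivity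
      linarith
    nlinarith [mul_le_mul_of_nonneg_left this hp]
  refine ⟨ε / 2, by positivity, fun g hg => ?_, fun c hc => ?_, fun c hc => ?_⟩
  · rw [dClosedLength_add m hg]
    have e1 := (abs_le.1 (hclosed y g hg)).1
    have e2 := D.size_le_fullSize y
    have e3 := D.closedLength_pos hg
    have e4 : A * D.size y * m.closedLength g ≤ ε / 2 * m.closedLength g :=
      mul_le_mul_of_nonneg_right ((mul_le_mul_of_nonneg_left e2 hA).trans hpA) e3.le
    linarith [h1 g hg]
  · rw [dConnLength_add]
    have e1 := (abs_le.1 (hconn y c)).1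
    have e2 : m.connLength c + E ≤ (1 + E / l₀) * m.connLength c := by
      have : E ≤ E / l₀ * m.connLength c := by
        rw [div_mul_eq_mul_div, le_div_iff₀ hl₀]
        exact mul_le_mul_of_nonneg_left (hlow c hc) hE
      linarith
    have e3 := mul_le_mul_of_nonneg_left e2 (mul_nonneg hB hp)
    have e4 := mul_le_mul_of_nonneg_right hpB hc.le
    linarith [h2 c hc]
  · rw [dConnLength_add]
    have e1 := (abs_le.1 (hconn y c)).1
    -- For nonpositive lengths only the additive constant `E` remains.
    have e2 : B * p * (m.connLength c + E) ≤ B * p * E :=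
      mul_le_mul_of_nonneg_left (by linarith) (mul_nonneg hB hp)
    linarith [h3 c hc]

end DecoratedMetric
end DecoratedSurface
end

/-! ### Passage to the quotient by trivial variations -/

theorem mainTheorem9 (r Q : ℕ) (m : DecoratedSurface.DecoratedMetric r Q) :
    IsOpen m.admissibleCone ∧ Convex ℝ m.admissibleCone ∧
      ∀ t : ℝ, 0 < t → ∀ w ∈ m.admissibleCone, t • w ∈ m.admissibleCone := by
  refine ⟨?_, ?_, ?_⟩
  -- The cone is by definition an image under the quotient map, which is open.
  · have h := Submodule.isOpenMap_mkQ (m.trivialVariations.comap m.variations.subtype) _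
      m.isOpen_uniformlyLengthens
    have e : m.admissibleCone = (m.trivialVariations.comap m.variations.subtype).mkQ ''
        {z | m.UniformlyLengthens z} := by
      ext w
      exact exists_congr fun z => and_comm
    rwa [e]
  · rintro _ ⟨z, rfl, hz⟩ _ ⟨z', rfl, hz'⟩ a b ha hb hab
    exact ⟨a • z + b • z', rfl, hz.combo hz' ha hb hab⟩
  · rintro t ht _ ⟨z, rfl, hz⟩
    exact ⟨t • z, rfl, hz.smul ht⟩
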